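/- Notation: $\{x\}=x-x^{-1}$, $A=q^N$, $D=\{A\}/\{q\}$, $\phi=A\{q\}$, $\bar\phi=-A^{-1}\{q\}$. The HOMFLY polynomial $H^{L}(q,A)$ of an oriented link diagram $L$ is $A^{-w(L)}$ ($w$ the writhe) times the $U_q(\mathfrak{sl}_N)$ state sum in the fundamental representation; it is normalised by $H^{\rm unknot}=D$. An antiparallel lock is a clasp of two arcs with four ends NW (incoming), NE (outgoing), SW (outgoing), SE (incoming): a vertical lock clasps an arc from NW to NE with an arc from SE to SW in two positive crossings; an inverse horizontal lock clasps an arc from NW to SW with an arc from SE to NE in two negative crossings. Write $\|$ for the tangle joining NW to SW and SE to NE, and $\asymp$ (cup-cap) for the one joining NW to NE and SE to SW. Fix $0\le k\le n$. A general vertex of the hypercube of bipartite diagrams is a tangle obtained by placing $n$ locks one below another, $k$ of them (in arbitrary positions) vertical and the other $n-k$ inverse horizontal. Its closed closure joins NW to SW and NE to SE, its open closure joins NW to NE and SW to SE. Put $$\Theta_{n,k}=\Theta_{n,k}(\phi,\bar\phi,D)=\frac{(D+\phi)^k(1+\bar\phi D)^{n-k}-\phi^k}{D}.$$ (1) Decomposition.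 For every $N\ge 1$, with $A=q^N$, the state sum of every such tangle (in the framing of the diagram) equals $\phi^k\,\|+\Theta_{n,k}\,\asymp$. The same decomposition holds for the formal planar resolution, for arbitrary elements $\phi,\bar\phi$ and $D\neq0$ of a field, in which a vertical lock is replaced by $\asymp+\phi\,\|$, an inverse horizontal lock by $\|+\bar\phi\asymp$, and every closed cycle by $D$; hence the planar state sums of the closures are $$P_{\rm op}=\phi^kD+\Theta_{n,k}D^2=D(D+\phi)^k(1+\bar\phi D)^{n-k},\qquad P_{\rm cl}=\phi^kD^2+\Theta_{n,k}D .$$ (2) Composition rule. For $0\le k\le n$, $0\le l\le m$, and arbitrary $\phi,\bar\phi$ and $D\ne0$ in a field, $$\Theta_{n+m,k+l}=\phi^k\,\Theta_{m,l}+\phi^l\,\Theta_{n,k}+D\,\Theta_{m,l}\,\Theta_{n,k};$$ equivalently, $\bar\Theta_{n+m,k+l}=\bar\phi^k\,\bar\Theta_{m,l}+\bar\phi^l\,\bar\Theta_{n,k}+D\,\bar\Theta_{m,l}\,\bar\Theta_{n,k}$ for $\bar\Theta_{n,k}=\Theta_{n,k}(\bar\phi,\phi,D)$. (3) HOMFLY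 polynomials of the closures. $$H_{\rm op}=A^{2n-4k}D(D+\phi)^k(1+\bar\phi D)^{n-k}=A^{-2k}D(D+\phi)^k=D^{k+1}\Big(1+\frac{\{Aq\}\{A/q\}}{\{A\}^{k}}F_{\rm op}\Big),$$ $$H_{\rm cl}=A^{2n-4k}\Big((D+\phi)^k(1+\bar\phi D)^{n-k}+\phi^k(D^2-1)\Big),$$ and, if $k\ge1$, $$H_{\rm cl}=D^{k}\Big(1+\frac{\{Aq\}\{A/q\}}{\{A\}^{k-1}}F_{\rm cl}\Big),$$ where $F_{\rm op},F_{\rm cl}\in\mathbb Z[q^{\pm1},A^{\pm1}]$. (4) Same precursor Jones polynomial. Shrinking every lock to a single crossing turns all $2^n$ vertices of the hypercube into the same diagram, a twist region with $n$ crossings in which the strand joining SW to NE passes over. Define the precursor Jones polynomial of a closure by $$J=(-1)^{\frac12(w+n_+-n_-)}\,q^{-\frac32w-\frac12(n_+-n_-)}\,P\big|_{\phi=-q,\ \bar\phi=-q^{-1},\ D=q+q^{-1}},$$ where $n_+=k$, $n_-=n-k$ and $w$ is the writhe of the precursor link diagram, both strands of the twist region being oriented downwards for the closed closure ($w=n$),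 and antiparallel for the open closure ($w=-n$). Then, for every vertex, $$J_{\rm op}=q+q^{-1},\qquad J_{\rm cl}=q^{-n}\big((-q^2)^{-n}+q^2+q^{-2}+1\big),$$ and these are the Jones polynomials (that is, $H$ at $A=q^2$) of the precursor link diagrams. -/

import Mathlib

open scoped LaurentPolynomial

/-! ### Oriented tangle diagrams -/

/-- Direction of a strand at a horizontal level of a diagram. -/
inductive Dir
  | dn
  | up
  deriving DecidableEq

/-- The opposite direction. -/
def Dir.rev : Dir → Dir
  | .dn => .up
  | .up => .dn

/-- Bracketed words of directed strand ends, read from left to right. -/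
inductive Bdry
  | nil
  | pt (d : Dir)
  | tensor (a b : Bdry)

infixr:70 " ⊠ " => Bdry.tensor

/-- The underlying unbracketed word. -/
def Bdry.toList : Bdry → List Dir
  | .nil => []
  | .pt d => [d]
  | .tensor a b => a.toList ++ b.toList

/-- A downward strand end. -/
abbrev Bdry.dn : Bdry := .pt .dn

/-- An upward strand end. -/
abbrev Bdry.up : Bdry := .pt .up

/-- Two antiparallel strand ends, the left one having direction `d`. -/
def Bdry.anti : Dir → Bdry
  | .dn => .dn ⊠ .up
  | .up => .up ⊠ .dn

/-- Oriented tangle diagrams, read from top to bottom, generated by vertical strands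
(with an arbitrary change of bracketing), crossings, caps `∩` and cups `∪` under vertical
composition and horizontal juxtaposition. In a positive crossing of two downward or two upward
strands the overpassing strand joins the lower left end to the upper right end. -/
inductive Tangle : Bdry → Bdry → Type
  | strands {a b : Bdry} (h : a.toList = b.toList) : Tangle a b
  | crossing (d : Dir) (positive : Bool) : Tangle (.pt d ⊠ .pt d) (.pt d ⊠ .pt d)
  | cap (d : Dir) : Tangle .nil (.pt d ⊠ .pt d.rev)
  | cup (d : Dir) : Tangle (.pt d ⊠ .pt d.rev) .nil
  | comp {a b c : Bdry} (S : Tangle a b) (T : Tangle b c) : Tangle a c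
  | tensor {a b c d : Bdry} (S : Tangle a b) (T : Tangle c d) : Tangle (a ⊠ c) (b ⊠ d)

infixr:65 " ⨟ " => Tangle.comp
infixr:72 " ⊠ₜ " => Tangle.tensor

/-- Identity tangle. -/
abbrev Tangle.idn (a : Bdry) : Tangle a a := .strands rfl

/-- Writhe: the number of positive crossings minus the number of negative ones. -/
def Tangle.writhe {a b : Bdry} : Tangle a b → ℤ
  | .strands _ => 0
  | .crossing _ ε => if ε then 1 else -1
  | .cap _ => 0
  | .cup _ => 0
  | .comp S T => S.writhe + T.writhe
  | .tensor S T => S.writhe + T.writhe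

/-! ### The `U_q(sl_N)` state sum in the fundamental representation -/

/-- Labellings of the strand ends by the basis `0, …, N - 1` of the fundamental
representation. -/
@[reducible]
def Lab (N : ℕ) : Bdry → Type
  | .nil => Unit
  | .pt _ => Fin N
  | .tensor a b => Lab N a × Lab N b

instance Lab.instFintype (N : ℕ) : (a : Bdry) → Fintype (Lab N a)
  | .nil => inferInstanceAs (Fintype Unit)
  | .pt _ => inferInstanceAs (Fintype (Fin N))
  | .tensor a b =>
    letI := Lab.instFintype N a
    letI := Lab.instFintype N b
    inferInstanceAs (Fintype (Lab N a × Lab N b))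

/-- The list of labels, read from left to right. -/
def Lab.flat {N : ℕ} : {a : Bdry} → Lab N a → List (Fin N)
  | .nil, _ => []
  | .pt _, i => [i]
  | .tensor _ _, (x, y) => Lab.flat x ++ Lab.flat y

/-- The fundamental `R`-matrix (`ε = true`) and its inverse (`ε = false`), for two downward strands
with labels `i, j` above and `k, l` below. -/
def rMatrix {K : Type*} [Field K] (q : K) {N : ℕ} (ε : Bool) (i j k l : Fin N) : K :=
  if ε then
    (if i = l ∧ j = k then (if i = j then q else 1) else 0)
      + (if i = k ∧ j = l ∧ i < j then q - q⁻¹ else 0)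
  else
    (if i = l ∧ j = k then (if i = j then q⁻¹ else 1) else 0)
      - (if i = k ∧ j = l ∧ j < i then q - q⁻¹ else 0)

/-- The weight `q ^ (2 i + 1 - N)`, so that the sum over the labels is the quantum dimension. -/
def quantumWeight {K : Type*} [Field K] (q : K) {N : ℕ} (i : Fin N) : K :=
  q ^ (2 * (i.val : ℤ) + 1 - (N : ℤ))

/-- The state sum of a tangle diagram in the framing given by the diagram: the matrix whose rows are
indexed by the labellings of the upper boundary and columns by those of the lower boundary. The
crossing of two upward strands is the rotation by `π` of the crossing of two downward strands. -/
def Tangle.RT {K : Type*} [Field K] (q : K) (N : ℕ) {a b : Bdry} :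
    Tangle a b → Matrix (Lab N a) (Lab N b) K
  | .strands _ => fun x y => if x.flat = y.flat then 1 else 0
  | .crossing .dn ε => fun (x y : Fin N × Fin N) => rMatrix q ε x.1 x.2 y.1 y.2
  | .crossing .up ε => fun (x y : Fin N × Fin N) => rMatrix q ε y.2 y.1 x.2 x.1
  | .cap .dn => fun _ (y : Fin N × Fin N) => if y.1 = y.2 then 1 else 0
  | .cap .up => fun _ (y : Fin N × Fin N) => if y.1 = y.2 then (quantumWeight q y.1)⁻¹ else 0
  | .cup .dn => fun (x : Fin N × Fin N) _ => if x.1 = x.2 then quantumWeight q x.1 else 0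
  | .cup .up => fun (x : Fin N × Fin N) _ => if x.1 = x.2 then 1 else 0
  | .comp S T => S.RT q N * T.RT q N
  | .tensor S T => Matrix.kronecker (S.RT q N) (T.RT q N)

/-- An oriented link diagram is a tangle diagram without boundary. -/
abbrev LinkDiagram : Type := Tangle .nil .nil

/-- The fundamental `sl_N` invariant `A ^ (-w)` times the state sum, `A = q ^ N`. -/
def LinkDiagram.slN {K : Type*} [Field K] (q : K) (N : ℕ) (L : LinkDiagram) : K :=
  (q ^ N) ^ (-Tangle.writhe L) * Tangle.RT q N L () ()

/-! ### The HOMFLY polynomial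

Laurent polynomials in `A` (the variable `T`) with coefficients in `ℚ(q)`. -/

/-- The variable `q` as an element of the field `ℚ(q)`. -/
noncomputable def qq : RatFunc ℚ := RatFunc.X

/-- `q` as a unit of `ℚ(q)`. -/
noncomputable def qUnit : (RatFunc ℚ)ˣ := Units.mk0 RatFunc.X RatFunc.X_ne_zero

/-- The specialisation `A = q ^ N`. -/
noncomputable def specA (N : ℕ) : (RatFunc ℚ)[T;T⁻¹] →+* RatFunc ℚ :=
  LaurentPolynomial.eval₂ (RingHom.id _) (qUnit ^ N)

/-- `H` is the (unreduced) HOMFLY polynomial of the link diagram `L`: for every `N ≥ 1` its value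
at `A = q ^ N` is the fundamental `sl_N` invariant of `L`. -/
def IsHOMFLY (L : LinkDiagram) (H : (RatFunc ℚ)[T;T⁻¹]) : Prop :=
  ∀ N : ℕ, 1 ≤ N → specA N H = LinkDiagram.slN qq N L

theorem qq_pow_injective : Function.Injective fun N : ℕ => qq ^ N := by
  intro a b h
  have h' : (algebraMap (Polynomial ℚ) (RatFunc ℚ)) (Polynomial.X ^ a)
      = algebraMap (Polynomial ℚ) (RatFunc ℚ) (Polynomial.X ^ b) := by
    simpa [qq, RatFunc.algebraMap_X] using h
  have h2 := RatFunc.algebraMap_injective ℚ h'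
  simpa using congrArg Polynomial.natDegree h2

/-- The HOMFLY polynomial is unique. -/
theorem IsHOMFLY.unique {L : LinkDiagram} {H H' : (RatFunc ℚ)[T;T⁻¹]} (h : IsHOMFLY L H)
    (h' : IsHOMFLY L H') : H = H' := by
  have h0 : ∀ N : ℕ, 1 ≤ N → specA N (H - H') = 0 := fun N hN => by
    rw [map_sub, h N hN, h' N hN, sub_self]
  obtain ⟨m, p, hp⟩ := LaurentPolynomial.exists_T_pow (H - H')
  have hroot : ∀ N : ℕ, 1 ≤ N → p.eval (qq ^ N) = 0 := fun N hN => by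
    have h1 : specA N (Polynomial.toLaurent p) = 0 := by rw [hp, map_mul, h0 N hN, zero_mul]
    have h2 : ((qUnit ^ N : (RatFunc ℚ)ˣ) : RatFunc ℚ) = qq ^ N := by simp [qUnit, qq]
    rw [specA, LaurentPolynomial.eval₂_toLaurent, h2] at h1
    simpa [Polynomial.eval₂_eq_eval_map] using h1
  have hp0 : p = 0 := by
    refine Polynomial.eq_zero_of_infinite_isRoot p (Set.Infinite.mono ?_
      (Set.infinite_range_of_injective
        (qq_pow_injective.comp (Nat.succ_injective))))
    rintro _ ⟨N, rfl⟩
    exact hroot (N + 1) (Nat.succ_le_succ (Nat.zero_le N))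
  rw [hp0, map_zero] at hp
  have h3 : H - H' = 0 := (LaurentPolynomial.isUnit_T (m : ℤ)).mul_left_eq_zero.mp hp.symm
  exact sub_eq_zero.mp h3

/-- `D = (A - A⁻¹) / (q - q⁻¹)`. -/
noncomputable def homD : (RatFunc ℚ)[T;T⁻¹] :=
  LaurentPolynomial.C (qq - qq⁻¹)⁻¹ * (LaurentPolynomial.T 1 - LaurentPolynomial.T (-1))

/-- `φ = A (q - q⁻¹)`. -/
noncomputable def homPhi : (RatFunc ℚ)[T;T⁻¹] :=
  LaurentPolynomial.T 1 * LaurentPolynomial.C (qq - qq⁻¹)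

/-- `φ̄ = - A⁻¹ (q - q⁻¹)`. -/
noncomputable def homPhiBar : (RatFunc ℚ)[T;T⁻¹] :=
  -(LaurentPolynomial.T (-1) * LaurentPolynomial.C (qq - qq⁻¹))

/-- `A - A⁻¹`. -/
noncomputable def braceA : (RatFunc ℚ)[T;T⁻¹] := LaurentPolynomial.T 1 - LaurentPolynomial.T (-1)

/-- `(A q - A⁻¹ q⁻¹) (A q⁻¹ - A⁻¹ q)`. -/
noncomputable def braceAqAq : (RatFunc ℚ)[T;T⁻¹] :=
  (LaurentPolynomial.T 1 * LaurentPolynomial.C qq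
      - LaurentPolynomial.T (-1) * LaurentPolynomial.C qq⁻¹)
    * (LaurentPolynomial.T 1 * LaurentPolynomial.C qq⁻¹
      - LaurentPolynomial.T (-1) * LaurentPolynomial.C qq)

/-- The map from Laurent polynomials in `A` over `ℤ[q, q⁻¹]` to Laurent polynomials in `A` over
`ℚ(q)`. -/
noncomputable def fromInt : ℤ[T;T⁻¹][T;T⁻¹] →+* (RatFunc ℚ)[T;T⁻¹] :=
  LaurentPolynomial.eval₂
    (LaurentPolynomial.C.comp (LaurentPolynomial.eval₂ (Int.castRingHom (RatFunc ℚ)) qUnit))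
    (LaurentPolynomial.isUnit_T 1).unit

/-! ### Antiparallel locks -/

/-- The crossing, of the given sign, of two antiparallel strands: a crossing of downward strands
rotated by a quarter turn. -/
def Tangle.sideCrossing (ε : Bool) : (d : Dir) → Tangle (.anti d) (.anti d.rev)
  | .dn =>
    (.strands rfl : Tangle (.dn ⊠ .up) (.nil ⊠ .dn ⊠ .up))
      ⨟ ((.cap .up : Tangle .nil (.up ⊠ .dn)) ⊠ₜ .idn (.dn ⊠ .up))
      ⨟ (.strands rfl : Tangle ((.up ⊠ .dn) ⊠ (.dn ⊠ .up)) (.up ⊠ (.dn ⊠ .dn) ⊠ .up))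
      ⨟ (.idn .up ⊠ₜ .crossing .dn ε ⊠ₜ .idn .up)
      ⨟ (.strands rfl : Tangle (.up ⊠ (.dn ⊠ .dn) ⊠ .up) ((.up ⊠ .dn) ⊠ (.dn ⊠ .up)))
      ⨟ (.idn (.up ⊠ .dn) ⊠ₜ (.cup .dn : Tangle (.dn ⊠ .up) .nil))
      ⨟ (.strands rfl : Tangle ((.up ⊠ .dn) ⊠ .nil) (.up ⊠ .dn))
  | .up =>
    (.strands rfl : Tangle (.up ⊠ .dn) ((.up ⊠ .dn) ⊠ .nil))
      ⨟ (.idn (.up ⊠ .dn) ⊠ₜ (.cap .dn : Tangle .nil (.dn ⊠ .up)))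
      ⨟ (.strands rfl : Tangle ((.up ⊠ .dn) ⊠ (.dn ⊠ .up)) (.up ⊠ (.dn ⊠ .dn) ⊠ .up))
      ⨟ (.idn .up ⊠ₜ .crossing .dn ε ⊠ₜ .idn .up)
      ⨟ (.strands rfl : Tangle (.up ⊠ (.dn ⊠ .dn) ⊠ .up) ((.up ⊠ .dn) ⊠ (.dn ⊠ .up)))
      ⨟ ((.cup .up : Tangle (.up ⊠ .dn) .nil) ⊠ₜ .idn (.dn ⊠ .up))
      ⨟ (.strands rfl : Tangle (.nil ⊠ .dn ⊠ .up) (.dn ⊠ .up))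

/-- A lock tangle: vertical or horizontal, made from two positive crossings or, for the inverse
lock, from two negative ones. -/
structure Lock where
  vertical : Bool
  inverse : Bool

/-- The oriented diagram of a lock, with ends: NW incoming, NE outgoing, SW outgoing, SE incoming.
In the vertical lock an arc from NW to NE clasps an arc from SE to SW, the two crossings lying side
by side; in the horizontal lock an arc from NW to SW clasps an arc from SE to NE, the two crossings
lying one above the other. -/
def Lock.tangle (t : Lock) : Tangle (.dn ⊠ .up) (.dn ⊠ .up) :=
  if t.vertical then
    (.strands rfl : Tangle (.dn ⊠ .up) (.dn ⊠ .nil ⊠ .up))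
      ⨟ (.idn .dn ⊠ₜ (.cap .dn : Tangle .nil (.dn ⊠ .up)) ⊠ₜ .idn .up)
      ⨟ (.strands rfl : Tangle (.dn ⊠ (.dn ⊠ .up) ⊠ .up) ((.dn ⊠ .dn) ⊠ (.up ⊠ .up)))
      ⨟ (.crossing .dn (!t.inverse) ⊠ₜ .crossing .up (!t.inverse))
      ⨟ (.strands rfl : Tangle ((.dn ⊠ .dn) ⊠ (.up ⊠ .up)) (.dn ⊠ (.dn ⊠ .up) ⊠ .up))
      ⨟ (.idn .dn ⊠ₜ (.cup .dn : Tangle (.dn ⊠ .up) .nil) ⊠ₜ .idn .up)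
      ⨟ (.strands rfl : Tangle (.dn ⊠ .nil ⊠ .up) (.dn ⊠ .up))
  else
    (Tangle.sideCrossing (!t.inverse) .dn : Tangle (.dn ⊠ .up) (.up ⊠ .dn))
      ⨟ (Tangle.sideCrossing (!t.inverse) .up : Tangle (.up ⊠ .dn) (.dn ⊠ .up))

/-- The planar tangle `||`. -/
def Tangle.par : Tangle (.dn ⊠ .up) (.dn ⊠ .up) := .idn _

/-- The planar tangle consisting of a cup above a cap. -/
def Tangle.cupcap : Tangle (.dn ⊠ .up) (.dn ⊠ .up) :=
  (.cup .dn : Tangle (.dn ⊠ .up) .nil) ⨟ (.cap .dn : Tangle .nil (.dn ⊠ .up))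

/-- The tangle obtained by placing `n` locks one below another. -/
def chainTangle : (n : ℕ) → (Fin n → Lock) → Tangle (.dn ⊠ .up) (.dn ⊠ .up)
  | 0, _ => .par
  | n + 1, v => (v 0).tangle ⨟ chainTangle n (Fin.tail v)

/-- The closed closure: NW is joined to SW around the left side and NE to SE around the right
side. -/
def closedClosure (X : Tangle (.dn ⊠ .up) (.dn ⊠ .up)) : LinkDiagram :=
  (.strands rfl : Tangle .nil (.nil ⊠ .nil))
    ⨟ ((.cap .up : Tangle .nil (.up ⊠ .dn)) ⊠ₜ (.cap .up : Tangle .nil (.up ⊠ .dn)))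
    ⨟ (.strands rfl : Tangle ((.up ⊠ .dn) ⊠ (.up ⊠ .dn)) (.up ⊠ (.dn ⊠ .up) ⊠ .dn))
    ⨟ (.idn .up ⊠ₜ X ⊠ₜ .idn .dn)
    ⨟ (.strands rfl : Tangle (.up ⊠ (.dn ⊠ .up) ⊠ .dn) ((.up ⊠ .dn) ⊠ (.up ⊠ .dn)))
    ⨟ ((.cup .up : Tangle (.up ⊠ .dn) .nil) ⊠ₜ (.cup .up : Tangle (.up ⊠ .dn) .nil))
    ⨟ (.strands rfl : Tangle (.nil ⊠ .nil) .nil)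

/-- The open closure: NW is joined to NE and SW is joined to SE. -/
def openClosure (X : Tangle (.dn ⊠ .up) (.dn ⊠ .up)) : LinkDiagram :=
  (.cap .dn : Tangle .nil (.dn ⊠ .up)) ⨟ X ⨟ (.cup .dn : Tangle (.dn ⊠ .up) .nil)

/-- The vertex of the hypercube of bipartite diagrams labelled by `S`: the locks at the positions in
`S` are vertical, those at the other positions are inverse horizontal. -/
def hypercubeVertex {n : ℕ} (S : Finset (Fin n)) (i : Fin n) : Lock :=
  if i ∈ S then ⟨true, false⟩ else ⟨false, true⟩

/-- `Θ_{n,k} = ((D + φ) ^ k * (1 + φ̄ D) ^ (n - k) - φ ^ k) / D`, for `k ≤ n`. -/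
def Theta {K : Type*} [Field K] (φ φbar D : K) (n k : ℕ) : K :=
  ((D + φ) ^ k * (1 + φbar * D) ^ (n - k) - φ ^ k) / D

/-! ### Planar resolutions of a chain of locks -/

/-- The two planar resolutions of a lock. -/
inductive Res
  | par
  | cupcap
  deriving DecidableEq

instance Res.instFintype : Fintype Res := ⟨{.par, .cupcap}, fun r => by cases r <;> simp⟩

/-- The weight of a resolution. A vertical lock is resolved as `cupcap + f ||`, a horizontal one as
`|| + f cupcap`, where `f` is `φ`, or `φ̄` for an inverse lock. -/
def Lock.weight {K : Type*} [Field K] (φ φbar : K) (t : Lock) (r : Res) : K :=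
  if (t.vertical = true ↔ r = .par) then (if t.inverse then φbar else φ) else 1

/-- The arcs of the planar tangle obtained by resolving the `i`-th lock (between the levels `i` and
`i + 1`) according to `s i`. The points are the left (`false`) and right (`true`) strand positions
at the levels `0, …, n`. -/
inductive TangleArc {n : ℕ} (s : Fin n → Res) : Fin (n + 1) × Bool → Fin (n + 1) × Bool → Prop
  | through (i : Fin n) (h : s i = .par) (b : Bool) : TangleArc s (i.castSucc, b) (i.succ, b)
  | cup (i : Fin n) (h : s i = .cupcap) : TangleArc s (i.castSucc, false) (i.castSucc, true)
  | cap (i : Fin n) (h : s i = .cupcap) : TangleArc s (i.succ, false) (i.succ, true)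

/-- The arcs of the closed closure of a resolved tangle. -/
inductive ClosedArc {n : ℕ} (s : Fin n → Res) : Fin (n + 1) × Bool → Fin (n + 1) × Bool → Prop
  | inner {x y : Fin (n + 1) × Bool} (h : TangleArc s x y) : ClosedArc s x y
  | outer (b : Bool) : ClosedArc s (0, b) (Fin.last n, b)

/-- The arcs of the open closure of a resolved tangle. -/
inductive OpenArc {n : ℕ} (s : Fin n → Res) : Fin (n + 1) × Bool → Fin (n + 1) × Bool → Prop
  | inner {x y : Fin (n + 1) × Bool} (h : TangleArc s x y) : OpenArc s x y
  | top : OpenArc s (0, false) (0, true)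
  | bottom : OpenArc s (Fin.last n, false) (Fin.last n, true)

/-- The curves of a planar picture: its points modulo the relation generated by its arcs. -/
abbrev Curves {P : Type} (arc : P → P → Prop) : Type := Quot arc

/-- The number of closed loops of a resolved tangle: its curves which contain no end. -/
noncomputable def loops {n : ℕ} (s : Fin n → Res) : ℕ :=
  Nat.card {c : Curves (TangleArc s) //
    ∀ b, c ≠ Quot.mk _ (0, b) ∧ c ≠ Quot.mk _ (Fin.last n, b)}

open Classical in
/-- The coefficient of `||` in the planar resolution of a chain of locks: the sum over the
resolutions that join NW to SW, with a factor `D` for each closed loop. -/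
noncomputable def parCoeff {K : Type*} [Field K] (φ φbar D : K) {n : ℕ} (v : Fin n → Lock) : K :=
  ∑ s : Fin n → Res,
    if (Quot.mk _ (0, false) : Curves (TangleArc s)) = Quot.mk _ (Fin.last n, false) then
      (∏ i, (v i).weight φ φbar (s i)) * D ^ loops s
    else 0

open Classical in
/-- The coefficient of the cup-cap in the planar resolution of a chain of locks: the sum over the
resolutions that join NW to NE, with a factor `D` for each closed loop. -/
noncomputable def cupcapCoeff {K : Type*} [Field K] (φ φbar D : K) {n : ℕ} (v : Fin n → Lock) : K :=
  ∑ s : Fin n → Res,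
    if (Quot.mk _ (0, false) : Curves (TangleArc s)) = Quot.mk _ (0, true) then
      (∏ i, (v i).weight φ φbar (s i)) * D ^ loops s
    else 0

/-- The planar state sum `∑ D ^ a φ ^ b φ̄ ^ c` over the hypercube of resolutions, `a` being the
number of cycles, for the closed closure of a chain of locks. -/
noncomputable def planarClosed {K : Type*} [Field K] (φ φbar D : K) {n : ℕ} (v : Fin n → Lock) :
    K :=
  ∑ s : Fin n → Res, (∏ i, (v i).weight φ φbar (s i)) * D ^ Nat.card (Curves (ClosedArc s))

/-- The planar state sum `∑ D ^ a φ ^ b φ̄ ^ c` over the hypercube of resolutions, `a` being the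
number of cycles, for the open closure of a chain of locks. -/
noncomputable def planarOpen {K : Type*} [Field K] (φ φbar D : K) {n : ℕ} (v : Fin n → Lock) : K :=
  ∑ s : Fin n → Res, (∏ i, (v i).weight φ φbar (s i)) * D ^ Nat.card (Curves (OpenArc s))

/-! ### Precursor diagrams and their Jones polynomials -/

/-- Shrinking a lock to one crossing, which has the same over-under information as the two crossings
of the lock. The value is `true` if the overpassing strand joins SW to NE. -/
def Lock.shrink (t : Lock) : Bool := t.vertical != t.inverse

/-- The unoriented precursor tangle of a chain of locks: a twist region with one crossing for each
lock. -/
def precursor {n : ℕ} (v : Fin n → Lock) : Fin n → Bool := fun i => (v i).shrink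

/-- The twist region with the given crossings, both strands oriented downwards. -/
def parallelTwist : (n : ℕ) → (Fin n → Bool) → Tangle (.dn ⊠ .dn) (.dn ⊠ .dn)
  | 0, _ => .idn _
  | n + 1, c => .crossing .dn (c 0) ⨟ parallelTwist n (Fin.tail c)

/-- The closed closure of a twist region, both strands of which are oriented downwards. -/
def precursorClosed {n : ℕ} (c : Fin n → Bool) : LinkDiagram :=
  (.strands rfl : Tangle .nil (.nil ⊠ .nil))
    ⨟ ((.cap .up : Tangle .nil (.up ⊠ .dn)) ⊠ₜ (.cap .dn : Tangle .nil (.dn ⊠ .up)))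
    ⨟ (.strands rfl : Tangle ((.up ⊠ .dn) ⊠ (.dn ⊠ .up)) (.up ⊠ (.dn ⊠ .dn) ⊠ .up))
    ⨟ (.idn .up ⊠ₜ parallelTwist n c ⊠ₜ .idn .up)
    ⨟ (.strands rfl : Tangle (.up ⊠ (.dn ⊠ .dn) ⊠ .up) ((.up ⊠ .dn) ⊠ (.dn ⊠ .up)))
    ⨟ ((.cup .up : Tangle (.up ⊠ .dn) .nil) ⊠ₜ (.cup .dn : Tangle (.dn ⊠ .up) .nil))
    ⨟ (.strands rfl : Tangle (.nil ⊠ .nil) .nil)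

/-- A twist region of two antiparallel strands, closed at the bottom by a cup. In the antiparallel
orientation a crossing with the strand from SW to NE above is negative. -/
def antiparallelTwist : (n : ℕ) → (Fin n → Bool) → (d : Dir) → Tangle (.anti d) .nil
  | 0, _, .dn => (.cup .dn : Tangle (.dn ⊠ .up) .nil)
  | 0, _, .up => (.cup .up : Tangle (.up ⊠ .dn) .nil)
  | n + 1, c, d => .sideCrossing (!c 0) d ⨟ antiparallelTwist n (Fin.tail c) d.rev

/-- The open closure of a twist region. -/
def precursorOpen {n : ℕ} (c : Fin n → Bool) : LinkDiagram :=
  (.cap .dn : Tangle .nil (.dn ⊠ .up)) ⨟ antiparallelTwist n c .dn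

/-- The framing factor `(-1) ^ ((w + n₊ - n₋) / 2) * q ^ (- 3 w / 2 - (n₊ - n₋) / 2)`; the exponents
are integers, since `w` and `n₊ - n₋` have the same parity. -/
def jonesFraming {K : Type*} [Field K] (q : K) (w nplus nminus : ℤ) : K :=
  (-1) ^ ((w + nplus - nminus) / 2) * q ^ (-((3 * w + nplus - nminus) / 2))

/-- The precursor Jones polynomial of the closed closure of a chain of locks, by the substitution
`φ = -q`, `φ̄ = -q⁻¹`, `D = q + q⁻¹` in the planar state sum; `n₊` and `n₋` are the numbers of
locks that are not, respectively are, inverse, and `w` is the writhe of the precursor. -/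
noncomputable def jonesClosed {n : ℕ} (v : Fin n → Lock) : RatFunc ℚ :=
  jonesFraming qq (Tangle.writhe (precursorClosed (precursor v)))
      (Finset.univ.filter fun i => (v i).inverse = false).card
      (Finset.univ.filter fun i => (v i).inverse = true).card
    * planarClosed (-qq) (-qq⁻¹) (qq + qq⁻¹) v

/-- The same for the open closure. -/
noncomputable def jonesOpen {n : ℕ} (v : Fin n → Lock) : RatFunc ℚ :=
  jonesFraming qq (Tangle.writhe (precursorOpen (precursor v)))
      (Finset.univ.filter fun i => (v i).inverse = false).card
      (Finset.univ.filter fun i => (v i).inverse = true).card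
    * planarOpen (-qq) (-qq⁻¹) (qq + qq⁻¹) v

/-! ### Curves of a planar resolution -/

section Planar

variable {n : ℕ}

/-- The last cupcap above a given level. -/
def lastCupcap (s : Fin n → Res) : Fin (n + 1) → Option {j : Fin n // s j = .cupcap} :=
  Fin.induction none fun i o => if h : s i = .cupcap then some ⟨i, h⟩ else o

@[simp]
theorem lastCupcap_zero (s : Fin n → Res) : lastCupcap s 0 = none := rfl

theorem lastCupcap_succ_of_cupcap {s : Fin n → Res} {i : Fin n} (h : s i = .cupcap) :
    lastCupcap s i.succ = some ⟨i, h⟩ := by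
  simp [lastCupcap, h]

theorem lastCupcap_succ_of_par {s : Fin n → Res} {i : Fin n} (h : s i = .par) :
    lastCupcap s i.succ = lastCupcap s i.castSucc := by
  simp [lastCupcap, h]

theorem Res.eq_par_or_cupcap (r : Res) : r = .par ∨ r = .cupcap := by
  cases r <;> simp

theorem TangleArc.lastCupcap_eq {s : Fin n → Res} {x y : Fin (n + 1) × Bool}
    (h : TangleArc s x y) : lastCupcap s x.1 = lastCupcap s y.1 := by
  cases h with
  | through i h b => exact (lastCupcap_succ_of_par h).symm
  | cup i h => rfl
  | cap i h => rfl

theorem OpenArc.lastCupcap_eq {s : Fin n → Res} {x y : Fin (n + 1) × Bool}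
    (h : OpenArc s x y) : lastCupcap s x.1 = lastCupcap s y.1 := by
  cases h with
  | inner h => exact h.lastCupcap_eq
  | top => rfl
  | bottom => rfl

theorem lastCupcap_eq_some {s : Fin n → Res} (i : Fin (n + 1)) (b : Bool) :
    ∀ j, lastCupcap s i = some j →
      (Quot.mk _ (i, b) : Curves (TangleArc s)) = Quot.mk _ (j.1.succ, false) := by
  induction i using Fin.induction with
  | zero => simp
  | succ i ih =>
    intro j hj
    rcases (s i).eq_par_or_cupcap with h | h
    · rw [lastCupcap_succ_of_par h] at hj
      rw [← ih j hj]
      exact (Quot.sound (.through i h b)).symm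
    · rw [lastCupcap_succ_of_cupcap h, Option.some.injEq] at hj
      subst hj
      cases b
      · rfl
      · exact (Quot.sound (.cap i h)).symm

theorem lastCupcap_eq_none {s : Fin n → Res} (i : Fin (n + 1)) (b : Bool) :
    lastCupcap s i = none →
      (Quot.mk _ (i, b) : Curves (TangleArc s)) = Quot.mk _ (0, b) := by
  induction i using Fin.induction with
  | zero => simp
  | succ i ih =>
    intro hj
    rcases (s i).eq_par_or_cupcap with h | h
    · rw [lastCupcap_succ_of_par h] at hj
      rw [← ih hj]
      exact (Quot.sound (.through i h b)).symm
    · simp [lastCupcap_succ_of_cupcap h] at hj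

theorem top_connected_of_lastCupcap_ne_none {s : Fin n → Res} (i : Fin (n + 1)) :
    lastCupcap s i ≠ none →
      (Quot.mk _ (0, false) : Curves (TangleArc s)) = Quot.mk _ (0, true) := by
  induction i using Fin.induction with
  | zero => simp
  | succ i ih =>
    intro hj
    rcases (s i).eq_par_or_cupcap with h | h
    · rw [lastCupcap_succ_of_par h] at hj
      exact ih hj
    · by_cases hi : lastCupcap s i.castSucc = none
      · rw [← lastCupcap_eq_none _ _ hi, ← lastCupcap_eq_none _ _ hi]
        exact Quot.sound (.cup i h)
      · exact ih hi

theorem lastCupcap_last_eq_none_iff {s : Fin n → Res} :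
    lastCupcap s (Fin.last n) = none ↔ ∀ i, s i = .par := by
  constructor
  · intro h
    have key : ∀ i : Fin (n + 1), lastCupcap s i = none := by
      intro i
      induction i using Fin.reverseInduction with
      | last => exact h
      | cast i ih =>
        rcases (s i).eq_par_or_cupcap with h' | h'
        · rwa [lastCupcap_succ_of_par h'] at ih
        · simp [lastCupcap_succ_of_cupcap h'] at ih
    intro i
    rcases (s i).eq_par_or_cupcap with h' | h'
    · exact h'
    · have := key i.succ
      simp [lastCupcap_succ_of_cupcap h'] at this
  · intro h
    have key : ∀ i : Fin (n + 1), lastCupcap s i = none := by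
      intro i
      induction i using Fin.induction with
      | zero => rfl
      | succ i ih => rw [lastCupcap_succ_of_par (h i), ih]
    exact key _

/-- The number of cupcaps of a resolution. -/
def numCupcap (s : Fin n → Res) : ℕ := Fintype.card {j : Fin n // s j = .cupcap}

theorem card_curves_openArc (s : Fin n → Res) :
    Nat.card (Curves (OpenArc s)) = numCupcap s + 1 := by
  have key : ∀ p : Fin (n + 1) × Bool,
      (lastCupcap s p.1).elim (Quot.mk _ (0, false) : Curves (OpenArc s))
        (fun j => Quot.mk _ (j.1.succ, false)) = Quot.mk _ p := by
    have emb : ∀ x y : Fin (n + 1) × Bool, (Quot.mk _ x : Curves (TangleArc s)) = Quot.mk _ y →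
        (Quot.mk _ x : Curves (OpenArc s)) = Quot.mk _ y := fun x y h =>
      congrArg (Quot.map id fun _ _ h => OpenArc.inner h) h
    rintro ⟨i, b⟩
    rcases h : lastCupcap s i with _ | j
    · simp only [Option.elim_none]
      rw [emb _ _ (lastCupcap_eq_none i b h)]
      cases b
      · rfl
      · exact Quot.sound .top
    · simp only [Option.elim_some]
      exact (emb _ _ (lastCupcap_eq_some i b j h)).symm
  let e : Curves (OpenArc s) ≃ Option {j : Fin n // s j = .cupcap} :=
    { toFun := Quot.lift (fun p => lastCupcap s p.1) fun _ _ h => h.lastCupcap_eq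
      invFun := fun o => o.elim (Quot.mk _ (0, false)) fun j => Quot.mk _ (j.1.succ, false)
      left_inv := by
        rintro ⟨p⟩
        exact key p
      right_inv := by
        rintro (_ | ⟨j, hj⟩)
        · rfl
        · exact lastCupcap_succ_of_cupcap hj }
  rw [Nat.card_congr e, Nat.card_eq_fintype_card, Fintype.card_option, numCupcap]

theorem card_curves_closedArc_of_forall_par {s : Fin n → Res} (hs : ∀ i, s i = .par) :
    Nat.card (Curves (ClosedArc s)) = 2 := by
  let e : Curves (ClosedArc s) ≃ Bool :=
    { toFun := Quot.lift (fun p => p.2) (by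
        rintro _ _ (⟨⟨i, h, b⟩ | ⟨i, h⟩ | ⟨i, h⟩⟩ | b)
        · rfl
        · simp [hs] at h
        · simp [hs] at h
        · rfl)
      invFun := fun b => Quot.mk _ (Fin.last n, b)
      left_inv := by
        rintro ⟨i, b⟩
        change Quot.mk _ (Fin.last n, b) = _
        induction i using Fin.reverseInduction with
        | last => rfl
        | cast i ih => exact ih.trans (Quot.sound (.inner (.through i (hs i) b))).symm
      right_inv := fun b => rfl }
  rw [Nat.card_congr e, Nat.card_eq_fintype_card, Fintype.card_bool]

theorem card_curves_closedArc {s : Fin n → Res} (hs : ¬ ∀ i, s i = .par) :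
    Nat.card (Curves (ClosedArc s)) = numCupcap s := by
  rw [← lastCupcap_last_eq_none_iff, ← ne_eq, Option.ne_none_iff_exists'] at hs
  obtain ⟨j₀, hj₀⟩ := hs
  have emb : ∀ x y : Fin (n + 1) × Bool, (Quot.mk _ x : Curves (TangleArc s)) = Quot.mk _ y →
      (Quot.mk _ x : Curves (ClosedArc s)) = Quot.mk _ y := fun x y h =>
    congrArg (Quot.map id fun _ _ h => ClosedArc.inner h) h
  let e : Curves (ClosedArc s) ≃ {j : Fin n // s j = .cupcap} :=
    { toFun := Quot.lift (fun p => (lastCupcap s p.1).getD j₀) (by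
        rintro _ _ (h | b)
        · exact congrArg (Option.getD · j₀) (by assumption : TangleArc s _ _).lastCupcap_eq
        · simp [hj₀])
      invFun := fun j => Quot.mk _ (j.1.succ, false)
      left_inv := by
        rintro ⟨i, b⟩
        change Quot.mk _ (((lastCupcap s i).getD j₀).1.succ, false) = _
        rcases h : lastCupcap s i with _ | j
        · rw [emb _ _ (lastCupcap_eq_none i b h)]
          exact (emb _ _ (lastCupcap_eq_some (Fin.last n) b j₀ hj₀)).symm.trans
            (Quot.sound (.outer b)).symm
        · exact (emb _ _ (lastCupcap_eq_some i b j h)).symm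
      right_inv := by
        rintro ⟨j, hj⟩
        change (lastCupcap s j.succ).getD j₀ = _
        rw [lastCupcap_succ_of_cupcap hj]
        rfl }
  rw [Nat.card_congr e, Nat.card_eq_fintype_card, numCupcap]

theorem left_connected_iff {s : Fin n → Res} :
    (Quot.mk _ (0, false) : Curves (TangleArc s)) = Quot.mk _ (Fin.last n, false)
      ↔ ∀ i, s i = .par := by
  rw [← lastCupcap_last_eq_none_iff]
  constructor
  · intro h
    exact (congrArg (Quot.lift (fun p => lastCupcap s p.1) fun _ _ h =>
      TangleArc.lastCupcap_eq h) h).symm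
  · exact fun h => (lastCupcap_eq_none _ _ h).symm

theorem top_connected_iff {s : Fin n → Res} :
    (Quot.mk _ (0, false) : Curves (TangleArc s)) = Quot.mk _ (0, true)
      ↔ ¬ ∀ i, s i = .par := by
  constructor
  · intro h hs
    have := congrArg (Quot.lift (fun p => p.2) (by
      rintro _ _ (⟨i, h, b⟩ | ⟨i, h⟩ | ⟨i, h⟩)
      · rfl
      · simp [hs] at h
      · simp [hs] at h)) h
    simp at this
  · rw [← lastCupcap_last_eq_none_iff]
    exact top_connected_of_lastCupcap_ne_none _

theorem loops_of_forall_par {s : Fin n → Res} (hs : ∀ i, s i = .par) : loops s = 0 := by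
  rw [loops, Nat.card_eq_zero]
  left
  constructor
  rintro ⟨⟨i, b⟩, hc⟩
  refine (hc b).1 (lastCupcap_eq_none i b ?_)
  induction i using Fin.induction with
  | zero => rfl
  | succ i ih =>
    rw [lastCupcap_succ_of_par (hs i)]
    refine ih ?_
    rwa [show (Quot.mk _ (i.castSucc, b) : Curves (TangleArc s)) = Quot.mk _ (i.succ, b) from
      Quot.sound (.through i (hs i) b)]

theorem loops_add_one {s : Fin n → Res} (hs : ¬ ∀ i, s i = .par) :
    loops s + 1 = numCupcap s := by
  have htop := top_connected_iff.2 hs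
  rw [← lastCupcap_last_eq_none_iff, ← ne_eq, Option.ne_none_iff_exists'] at hs
  obtain ⟨j₀, hj₀⟩ := hs
  have hzero : ∀ b, (Quot.mk _ (0, b) : Curves (TangleArc s)) = Quot.mk _ (0, false) := by
    rintro (_ | _)
    · rfl
    · exact htop.symm
  let F : Curves (TangleArc s) → Option {j : Fin n // s j = .cupcap} :=
    Quot.lift (fun p => lastCupcap s p.1) fun _ _ h => h.lastCupcap_eq
  have hF : ∀ j : {j : Fin n // s j = .cupcap}, F (Quot.mk _ (j.1.succ, false)) = some j :=
    fun j => lastCupcap_succ_of_cupcap j.2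
  have hF0 : ∀ b, F (Quot.mk _ (0, b)) = none := fun b => rfl
  have hFl : ∀ b, F (Quot.mk _ (Fin.last n, b)) = some j₀ := fun b => hj₀
  let G : {j : {j : Fin n // s j = .cupcap} // j ≠ j₀} → {c : Curves (TangleArc s) //
      ∀ b, c ≠ Quot.mk _ (0, b) ∧ c ≠ Quot.mk _ (Fin.last n, b)} := fun j =>
    ⟨Quot.mk _ (j.1.1.succ, false), fun b => ⟨fun h => by
      have := congrArg F h
      rw [hF, hF0] at this
      simp at this, fun h => by
      have := congrArg F h
      rw [hF, hFl, Option.some.injEq] at this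
      exact j.2 this⟩⟩
  have hG : Function.Bijective G := by
    constructor
    · intro j j' h
      have := congrArg (fun c => F c.1) h
      simp only [G, hF, Option.some.injEq] at this
      exact Subtype.ext this
    · rintro ⟨⟨i, b⟩, hc⟩
      rcases h : lastCupcap s i with _ | j
      · exact absurd (lastCupcap_eq_none i b h) (hc b).1
      · have hj := lastCupcap_eq_some i b j h
        refine ⟨⟨j, ?_⟩, Subtype.ext hj.symm⟩
        rintro rfl
        exact (hc false).2 (hj.trans (lastCupcap_eq_some (Fin.last n) false j hj₀).symm)
  have : 0 < Fintype.card {j : Fin n // s j = .cupcap} := Fintype.card_pos_iff.2 ⟨j₀⟩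
  rw [loops, ← Nat.card_congr (Equiv.ofBijective G hG), Nat.card_eq_fintype_card,
    Fintype.card_subtype_compl, Fintype.card_subtype_eq, numCupcap]
  omega

end Planar

/-! ### Planar state sums -/

section PlanarSums

variable {K : Type*} [Field K] {n : ℕ}

theorem sum_res {M : Type*} [AddCommMonoid M] (f : Res → M) : ∑ r, f r = f .par + f .cupcap := by
  have : (Finset.univ : Finset Res) = {.par, .cupcap} := rfl
  rw [this, Finset.sum_pair (by decide)]

theorem sum_prod_weight_mul_pow_numCupcap (φ φbar D : K) (v : Fin n → Lock) :
    ∑ s : Fin n → Res, (∏ i, (v i).weight φ φbar (s i)) * D ^ numCupcap s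
      = ∏ i, ((v i).weight φ φbar .par + (v i).weight φ φbar .cupcap * D) := by
  have h : ∀ s : Fin n → Res, (∏ i, (v i).weight φ φbar (s i)) * D ^ numCupcap s
      = ∏ i, ((v i).weight φ φbar (s i) * if s i = .cupcap then D else 1) := by
    intro s
    rw [Finset.prod_mul_distrib, numCupcap, Fintype.card_subtype, Finset.prod_ite]
    simp
  simp_rw [h]
  rw [← Fintype.piFinset_univ, ← Finset.prod_univ_sum (fun _ => Finset.univ)
    fun i r => (v i).weight φ φbar r * if r = .cupcap then D else 1]
  simp [sum_res]

@[to_additive]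
theorem prod_hypercubeVertex {M : Type*} [CommMonoid M] (S : Finset (Fin n)) (f : Lock → M) :
    ∏ i, f (hypercubeVertex S i) = f ⟨true, false⟩ ^ S.card * f ⟨false, true⟩ ^ (n - S.card) := by
  have h : ∀ i, f (hypercubeVertex S i)
      = if i ∈ S then f ⟨true, false⟩ else f ⟨false, true⟩ := by
    intro i
    rw [hypercubeVertex]
    split_ifs <;> rfl
  simp_rw [h]
  rw [Finset.prod_ite, Finset.prod_const, Finset.prod_const, Finset.filter_mem_eq_inter,
    Finset.univ_inter, ← Finset.compl_filter, Finset.filter_mem_eq_inter, Finset.univ_inter,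
    Finset.card_compl, Fintype.card_fin]

theorem prod_weight_par (φ φbar : K) (S : Finset (Fin n)) :
    ∏ i, (hypercubeVertex S i).weight φ φbar .par = φ ^ S.card := by
  rw [prod_hypercubeVertex S fun t => t.weight φ φbar .par]
  simp [Lock.weight]

theorem sum_prod_weight_hypercubeVertex (φ φbar D : K) (S : Finset (Fin n)) :
    ∑ s : Fin n → Res, (∏ i, (hypercubeVertex S i).weight φ φbar (s i)) * D ^ numCupcap s
      = (D + φ) ^ S.card * (1 + φbar * D) ^ (n - S.card) := by
  rw [sum_prod_weight_mul_pow_numCupcap, prod_hypercubeVertex S fun t =>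
    t.weight φ φbar .par + t.weight φ φbar .cupcap * D]
  simp [Lock.weight, add_comm]

theorem forall_eq_par_iff {s : Fin n → Res} : (∀ i, s i = .par) ↔ s = fun _ => .par :=
  funext_iff.symm

theorem numCupcap_par : numCupcap (fun _ : Fin n => Res.par) = 0 := by
  simp [numCupcap]

/-- A sum over resolutions, with the resolution consisting of strands only treated separately. -/
theorem sum_ite_forall_par (φ φbar D : K) (S : Finset (Fin n)) (c : K) :
    ∑ s : Fin n → Res, (∏ i, (hypercubeVertex S i).weight φ φbar (s i))
        * (if s = fun _ => .par then c else D ^ numCupcap s)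
      = (D + φ) ^ S.card * (1 + φbar * D) ^ (n - S.card) + φ ^ S.card * (c - 1) := by
  rw [← sum_prod_weight_hypercubeVertex, ← prod_weight_par φ φbar S]
  rw [← Finset.add_sum_erase _ _ (Finset.mem_univ fun _ => Res.par),
    ← Finset.add_sum_erase _ (fun s => _ * _ ^ numCupcap s) (Finset.mem_univ fun _ => Res.par)]
  rw [Finset.sum_congr rfl fun s hs => by rw [if_neg (Finset.ne_of_mem_erase hs)]]
  rw [if_pos rfl, numCupcap_par]
  ring

theorem Theta_mul_self {φ φbar D : K} (hD : D ≠ 0) (n k : ℕ) :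
    Theta φ φbar D n k * D = (D + φ) ^ k * (1 + φbar * D) ^ (n - k) - φ ^ k :=
  div_mul_cancel₀ _ hD

theorem parCoeff_hypercubeVertex (φ φbar D : K) (S : Finset (Fin n)) :
    parCoeff φ φbar D (hypercubeVertex S) = φ ^ S.card := by
  rw [parCoeff, ← prod_weight_par φ φbar S, Finset.sum_eq_single fun _ => Res.par]
  · rw [if_pos (left_connected_iff.2 fun _ => rfl), loops_of_forall_par fun _ => rfl, pow_zero,
      mul_one]
  · intro s _ hs
    rw [if_neg]
    rwa [left_connected_iff, forall_eq_par_iff]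
  · simp

theorem cupcapCoeff_hypercubeVertex (φ φbar : K) {D : K} (hD : D ≠ 0) (S : Finset (Fin n)) :
    cupcapCoeff φ φbar D (hypercubeVertex S) = Theta φ φbar D n S.card := by
  apply mul_right_cancel₀ hD
  have h := sum_ite_forall_par φ φbar D S 0
  rw [Theta_mul_self hD, cupcapCoeff, Finset.sum_mul]
  rw [zero_sub, mul_neg_one, ← sub_eq_add_neg] at h
  rw [← h]
  refine Finset.sum_congr rfl fun s _ => ?_
  by_cases hs : s = fun _ => .par
  · rw [if_neg (by rwa [top_connected_iff, not_not, forall_eq_par_iff]), if_pos hs]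
    ring
  · rw [← forall_eq_par_iff] at hs
    rw [if_pos (top_connected_iff.2 hs), if_neg (by rwa [← forall_eq_par_iff]),
      ← loops_add_one hs]
    ring

theorem planarOpen_hypercubeVertex (φ φbar D : K) (S : Finset (Fin n)) :
    planarOpen φ φbar D (hypercubeVertex S)
      = D * (D + φ) ^ S.card * (1 + φbar * D) ^ (n - S.card) := by
  rw [planarOpen, mul_assoc, ← sum_prod_weight_hypercubeVertex, Finset.mul_sum]
  refine Finset.sum_congr rfl fun s _ => ?_
  rw [card_curves_openArc]
  ring

theorem planarClosed_hypercubeVertex (φ φbar D : K) (S : Finset (Fin n)) :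
    planarClosed φ φbar D (hypercubeVertex S)
      = (D + φ) ^ S.card * (1 + φbar * D) ^ (n - S.card) + φ ^ S.card * (D ^ 2 - 1) := by
  rw [planarClosed, ← sum_ite_forall_par]
  refine Finset.sum_congr rfl fun s _ => ?_
  by_cases hs : s = fun _ => .par
  · rw [if_pos hs, card_curves_closedArc_of_forall_par (forall_eq_par_iff.2 hs)]
  · rw [if_neg hs, card_curves_closedArc (by rwa [forall_eq_par_iff])]

theorem Theta_add {φ φbar D : K} (hD : D ≠ 0) {n m k l : ℕ} (hk : k ≤ n) (hl : l ≤ m) :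
    Theta φ φbar D (n + m) (k + l)
      = φ ^ k * Theta φ φbar D m l + φ ^ l * Theta φ φbar D n k
        + D * Theta φ φbar D m l * Theta φ φbar D n k := by
  have h : n + m - (k + l) = (n - k) + (m - l) := by omega
  simp only [Theta, h, pow_add]
  field_simp
  ring

end PlanarSums

/-! ### Evaluation of the state sum -/

section StateSum

variable {K : Type*} [Field K] (q : K) {N : ℕ}

theorem Lab.length_flat : {a : Bdry} → (x : Lab N a) → x.flat.length = a.toList.length
  | .nil, _ => rfl
  | .pt _, _ => rfl
  | .tensor _ _, (x, y) => by
    simp only [Lab.flat, Bdry.toList, List.length_append, Lab.length_flat x, Lab.length_flat y]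

theorem Lab.flat_injective : {a : Bdry} → Function.Injective (Lab.flat : Lab N a → List (Fin N))
  | .nil, _, _, _ => rfl
  | .pt _, _, _, h => List.singleton_injective h
  | .tensor _ _, (x, y), (x', y'), h => by
    obtain ⟨h₁, h₂⟩ := List.append_inj h (by rw [Lab.length_flat, Lab.length_flat])
    exact Prod.ext (Lab.flat_injective h₁) (Lab.flat_injective h₂)

theorem sum_lab_tensor {a b : Bdry} (f : Lab N (a ⊠ b) → K) :
    ∑ z, f z = ∑ x : Lab N a, ∑ y : Lab N b, f (x, y) :=
  Fintype.sum_prod_type f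

theorem sum_lab_pair {d d' : Dir} (f : Lab N (.pt d ⊠ .pt d') → K) :
    ∑ z, f z = ∑ x : Fin N, ∑ y : Fin N, f (x, y) :=
  sum_lab_tensor f

theorem sum_lab_nil (f : Lab N .nil → K) : ∑ z, f z = f () :=
  Fintype.sum_unique (ι := Unit) f

namespace Tangle

variable {a b c d a' b' c' : Bdry}

theorem RT_comp_apply (S : Tangle a b) (T : Tangle b c) (x : Lab N a) (z : Lab N c) :
    (S ⨟ T).RT q N x z = ∑ y, S.RT q N x y * T.RT q N y z :=
  Matrix.mul_apply

theorem RT_strands_comp {h : a.toList = b.toList} {T : Tangle b c} {x : Lab N a} (y : Lab N b)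
    (hxy : x.flat = y.flat) (z : Lab N c) : (strands h ⨟ T).RT q N x z = T.RT q N y z := by
  rw [RT_comp_apply, Finset.sum_eq_single y]
  · simp [RT, hxy]
  · intro y' _ hy'
    have : x.flat ≠ y'.flat := fun h' => hy' (Lab.flat_injective (h'.symm.trans hxy))
    simp [RT, this]
  · simp

theorem RT_idn [DecidableEq (Lab N a)] (x y : Lab N a) :
    (idn a).RT q N x y = if x = y then 1 else 0 := by
  simp [RT, Lab.flat_injective.eq_iff]

theorem RT_tensor_comp (S : Tangle a b) (S' : Tangle a' b') (T : Tangle (b ⊠ b') c)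
    (x : Lab N a) (x' : Lab N a') (z : Lab N c) :
    ((S ⊠ₜ S') ⨟ T).RT q N (x, x') z
      = ∑ y, ∑ y', S.RT q N x y * S'.RT q N x' y' * T.RT q N (y, y') z := by
  rw [RT_comp_apply, sum_lab_tensor]
  rfl

open Classical in
theorem RT_idn_tensor_comp (S' : Tangle a' b') (T : Tangle (a ⊠ b') c)
    (x : Lab N a) (x' : Lab N a') (z : Lab N c) :
    ((idn a ⊠ₜ S') ⨟ T).RT q N (x, x') z
      = ∑ y', S'.RT q N x' y' * T.RT q N (x, y') z := by
  rw [RT_tensor_comp, Finset.sum_eq_single x]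
  · simp [RT_idn]
  · intro y _ hy
    simp [RT_idn, hy.symm]
  · simp

open Classical in
theorem RT_tensor_idn_comp (S : Tangle a b) (T : Tangle (b ⊠ a') c)
    (x : Lab N a) (x' : Lab N a') (z : Lab N c) :
    ((S ⊠ₜ idn a') ⨟ T).RT q N (x, x') z
      = ∑ y, S.RT q N x y * T.RT q N (y, x') z := by
  rw [RT_tensor_comp]
  refine Finset.sum_congr rfl fun y _ => ?_
  rw [Finset.sum_eq_single x']
  · simp [RT_idn]
  · intro y' _ hy
    simp [RT_idn, hy.symm]
  · simp

open Classical in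
theorem RT_idn_tensor_idn_comp (S : Tangle a b) (T : Tangle (a' ⊠ b ⊠ b') c)
    (x' : Lab N a') (x : Lab N a) (x'' : Lab N b') (z : Lab N c) :
    ((idn a' ⊠ₜ S ⊠ₜ idn b') ⨟ T).RT q N (x', x, x'') z
      = ∑ y, S.RT q N x y * T.RT q N (x', y, x'') z := by
  rw [RT_idn_tensor_comp, sum_lab_tensor]
  refine Finset.sum_congr rfl fun y _ => ?_
  have h : ∀ y'', (S ⊠ₜ idn b').RT q N (x, x'') (y, y'')
      = S.RT q N x y * if x'' = y'' then 1 else 0 := fun y'' => by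
    rw [← RT_idn q]
    rfl
  simp [h]

/-- The weight of a cap. -/
def capWeight : Dir → Fin N → K
  | .dn, _ => 1
  | .up, i => (quantumWeight q i)⁻¹

/-- The weight of a cup. -/
def cupWeight : Dir → Fin N → K
  | .dn, i => quantumWeight q i
  | .up, _ => 1

theorem RT_cap (d : Dir) (u : Lab N .nil) (i j : Fin N) :
    (cap d).RT q N u (i, j) = if i = j then capWeight q d i else 0 := by
  cases d <;> rfl

theorem RT_cup (d : Dir) (u : Lab N .nil) (i j : Fin N) :
    (cup d).RT q N (i, j) u = if i = j then cupWeight q d i else 0 := by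
  cases d <;> rfl

theorem sum_RT_cap (d : Dir) (u : Lab N .nil) (f : Lab N (.pt d ⊠ .pt d.rev) → K) :
    ∑ y, (cap d).RT q N u y * f y = ∑ i : Fin N, capWeight q d i * f (i, i) := by
  refine (sum_lab_pair _).trans (Finset.sum_congr rfl fun i _ => ?_)
  calc _ = ∑ j : Fin N, (if i = j then capWeight q d i else 0) * f (i, j) :=
        Finset.sum_congr rfl fun j _ => congrArg (· * f (i, j)) (RT_cap q d u i j)
    _ = _ := by simp

theorem sum_RT_cup (d : Dir) (i j : Fin N) (f : Lab N .nil → K) :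
    ∑ y, (cup d).RT q N (i, j) y * f y = if i = j then cupWeight q d i * f () else 0 :=
  (sum_lab_nil _).trans <| (congrArg (· * f ()) (RT_cup q d () i j)).trans <| by
    rw [ite_mul, zero_mul]

theorem RT_crossing_dn (ε : Bool) (i j k l : Fin N) :
    (crossing .dn ε).RT q N (i, j) (k, l) = rMatrix q ε i j k l := rfl

theorem RT_comp_cup (d : Dir) (T : Tangle c (.pt d ⊠ .pt d.rev)) (u : Lab N .nil) (z : Lab N c) :
    (T ⨟ cup d).RT q N z u = ∑ i : Fin N, T.RT q N z (i, i) * cupWeight q d i := by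
  refine (RT_comp_apply q T (cup d) z u).trans <|
    (sum_lab_pair _).trans (Finset.sum_congr rfl fun i _ => ?_)
  calc _ = ∑ j : Fin N, T.RT q N z (i, j) * (if i = j then cupWeight q d i else 0) :=
        Finset.sum_congr rfl fun j _ => congrArg (T.RT q N z (i, j) * ·) (RT_cup q d u i j)
    _ = _ := by simp

section Eval

variable {z : Lab N c} {r : K}

theorem RT_strands_comp_eq {h : a.toList = b.toList} {T : Tangle b c} {x : Lab N a} (y : Lab N b)
    (hxy : x.flat = y.flat) (hT : T.RT q N y z = r) : (strands h ⨟ T).RT q N x z = r :=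
  (RT_strands_comp q y hxy z).trans hT

theorem RT_cap_comp_eq {d : Dir} {T : Tangle (.pt d ⊠ .pt d.rev) c} {u : Lab N .nil}
    {f : Fin N → K} (hT : ∀ i : Fin N, T.RT q N (i, i) z = f i) :
    (cap d ⨟ T).RT q N u z = ∑ i, capWeight q d i * f i :=
  (RT_comp_apply q _ T _ _).trans <| (sum_RT_cap q d u _).trans <| by simp only [hT]

theorem RT_cup_comp_eq {d : Dir} {T : Tangle .nil c} {i j : Fin N}
    (hT : T.RT q N () z = r) :
    (cup d ⨟ T).RT q N (i, j) z = if i = j then cupWeight q d i * r else 0 :=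
  (RT_comp_apply q _ T _ _).trans <| (sum_RT_cup q d i j _).trans <| by simp only [hT]

theorem RT_cap_tensor_idn_comp_eq {d : Dir} {T : Tangle ((.pt d ⊠ .pt d.rev) ⊠ a) c}
    {u : Lab N .nil} {x : Lab N a} {f : Fin N → K}
    (hT : ∀ i : Fin N, T.RT q N ((i, i), x) z = f i) :
    ((cap d ⊠ₜ idn a) ⨟ T).RT q N (u, x) z = ∑ i, capWeight q d i * f i :=
  (RT_tensor_idn_comp q _ T _ _ _).trans <| (sum_RT_cap q d u _).trans <| by simp only [hT]

theorem RT_idn_tensor_cap_comp_eq {d : Dir} {T : Tangle (a ⊠ .pt d ⊠ .pt d.rev) c}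
    {u : Lab N .nil} {x : Lab N a} {f : Fin N → K}
    (hT : ∀ i : Fin N, T.RT q N (x, i, i) z = f i) :
    ((idn a ⊠ₜ cap d) ⨟ T).RT q N (x, u) z = ∑ i, capWeight q d i * f i :=
  (RT_idn_tensor_comp q _ T _ _ _).trans <| (sum_RT_cap q d u _).trans <| by simp only [hT]

theorem RT_idn_tensor_cap_tensor_idn_comp_eq {d : Dir}
    {T : Tangle (a ⊠ (.pt d ⊠ .pt d.rev) ⊠ b) c}
    {u : Lab N .nil} {x : Lab N a} {y : Lab N b} {f : Fin N → K}
    (hT : ∀ i : Fin N, T.RT q N (x, (i, i), y) z = f i) :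
    ((idn a ⊠ₜ cap d ⊠ₜ idn b) ⨟ T).RT q N (x, u, y) z = ∑ i, capWeight q d i * f i :=
  (RT_idn_tensor_idn_comp q _ T _ _ _ _).trans <| (sum_RT_cap q d u _).trans <| by simp only [hT]

theorem RT_cap_tensor_cap_comp_eq {d d' : Dir}
    {T : Tangle ((.pt d ⊠ .pt d.rev) ⊠ (.pt d' ⊠ .pt d'.rev)) c}
    {u u' : Lab N .nil} {f : Fin N → Fin N → K}
    (hT : ∀ i j : Fin N, T.RT q N ((i, i), (j, j)) z = f i j) :
    ((cap d ⊠ₜ cap d') ⨟ T).RT q N (u, u') z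
      = ∑ i, ∑ j, capWeight q d i * capWeight q d' j * f i j := by
  refine (RT_tensor_comp q _ _ T _ _ _).trans ?_
  simp only [mul_assoc, ← Finset.mul_sum]
  refine (sum_RT_cap q d u _).trans (Finset.sum_congr rfl fun i _ => congrArg _ ?_)
  refine (sum_RT_cap q d' u' _).trans (Finset.sum_congr rfl fun j _ => congrArg _ ?_)
  exact hT i j

theorem RT_cup_tensor_idn_comp_eq {d : Dir} {T : Tangle (.nil ⊠ a) c} {i j : Fin N}
    {x : Lab N a} (hT : T.RT q N ((), x) z = r) :
    ((cup d ⊠ₜ idn a) ⨟ T).RT q N ((i, j), x) z = if i = j then cupWeight q d i * r else 0 :=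
  (RT_tensor_idn_comp q _ T _ _ _).trans <| (sum_RT_cup q d i j _).trans <| by simp only [hT]

theorem RT_idn_tensor_cup_comp_eq {d : Dir} {T : Tangle (a ⊠ .nil) c} {i j : Fin N}
    {x : Lab N a} (hT : T.RT q N (x, ()) z = r) :
    ((idn a ⊠ₜ cup d) ⨟ T).RT q N (x, (i, j)) z = if i = j then cupWeight q d i * r else 0 :=
  (RT_idn_tensor_comp q _ T _ _ _).trans <| (sum_RT_cup q d i j _).trans <| by simp only [hT]

theorem RT_idn_tensor_cup_tensor_idn_comp_eq {d : Dir} {T : Tangle (a ⊠ .nil ⊠ b) c} {i j : Fin N}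
    {x : Lab N a} {y : Lab N b} (hT : T.RT q N (x, (), y) z = r) :
    ((idn a ⊠ₜ cup d ⊠ₜ idn b) ⨟ T).RT q N (x, (i, j), y) z
      = if i = j then cupWeight q d i * r else 0 :=
  (RT_idn_tensor_idn_comp q _ T _ _ _ _).trans <| (sum_RT_cup q d i j _).trans <| by simp only [hT]

theorem RT_cup_tensor_cup_comp_eq {d d' : Dir} {T : Tangle (.nil ⊠ .nil) c} {i j k l : Fin N}
    (hT : T.RT q N ((), ()) z = r) :
    ((cup d ⊠ₜ cup d') ⨟ T).RT q N ((i, j), (k, l)) z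
      = if i = j then cupWeight q d i * if k = l then cupWeight q d' k * r else 0 else 0 := by
  refine (RT_tensor_comp q _ _ T _ _ _).trans ?_
  refine (sum_lab_nil _).trans ((sum_lab_nil _).trans ?_)
  rw [hT, ← mul_ite_zero, mul_assoc]
  refine (congrArg₂ (fun x y => x * (y * r)) (RT_cup q d () i j) (RT_cup q d' () k l)).trans ?_
  split_ifs <;> simp

theorem RT_idn_tensor_pair_tensor_idn_comp_eq {d d' e e' : Dir}
    {X : Tangle (.pt d ⊠ .pt d') (.pt e ⊠ .pt e')}
    {T : Tangle (a ⊠ (.pt e ⊠ .pt e') ⊠ b) c} {x : Lab N a} {y : Lab N b} {i j : Fin N}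
    {g f : Fin N → Fin N → K} (hX : ∀ i' j' : Fin N, X.RT q N (i, j) (i', j') = g i' j')
    (hT : ∀ i' j' : Fin N, T.RT q N (x, (i', j'), y) z = f i' j') :
    ((idn a ⊠ₜ X ⊠ₜ idn b) ⨟ T).RT q N (x, (i, j), y) z = ∑ i', ∑ j', g i' j' * f i' j' :=
  (RT_idn_tensor_idn_comp q _ T _ _ _ _).trans <| (sum_lab_pair _).trans <|
    Finset.sum_congr rfl fun i' _ => Finset.sum_congr rfl fun j' _ =>
      congrArg₂ (· * ·) (hX i' j') (hT i' j')

theorem RT_pair_comp_eq {d d' e e' : Dir}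
    {X : Tangle (.pt d ⊠ .pt d') (.pt e ⊠ .pt e')} {T : Tangle (.pt e ⊠ .pt e') c} {i j : Fin N}
    {g f : Fin N → Fin N → K} (hX : ∀ i' j' : Fin N, X.RT q N (i, j) (i', j') = g i' j')
    (hT : ∀ i' j' : Fin N, T.RT q N (i', j') z = f i' j') :
    (X ⨟ T).RT q N (i, j) z = ∑ i', ∑ j', g i' j' * f i' j' :=
  (RT_comp_apply q _ T _ _).trans <| (sum_lab_pair _).trans <|
    Finset.sum_congr rfl fun i' _ => Finset.sum_congr rfl fun j' _ =>
      congrArg₂ (· * ·) (hX i' j') (hT i' j')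

theorem RT_crossing_tensor_crossing_comp_eq {ε ε' : Bool}
    {T : Tangle ((.dn ⊠ .dn) ⊠ (.up ⊠ .up)) c} {i j k l : Fin N}
    {f : Fin N → Fin N → Fin N → Fin N → K}
    (hT : ∀ i' j' k' l' : Fin N, T.RT q N ((i', j'), (k', l')) z = f i' j' k' l') :
    ((crossing .dn ε ⊠ₜ crossing .up ε') ⨟ T).RT q N ((i, j), (k, l)) z
      = ∑ i', ∑ j', ∑ k', ∑ l', rMatrix q ε i j i' j' * rMatrix q ε' l' k' l k * f i' j' k' l' :=
  (RT_tensor_comp q _ _ T _ _ _).trans <| (sum_lab_pair _).trans <|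
    Finset.sum_congr rfl fun i' _ => Finset.sum_congr rfl fun j' _ =>
      (sum_lab_pair _).trans <| Finset.sum_congr rfl fun k' _ => Finset.sum_congr rfl fun l' _ =>
        congrArg (rMatrix q ε i j i' j' * rMatrix q ε' l' k' l k * ·) (hT i' j' k' l')

end Eval

theorem RT_strands_pair {d d' : Dir} {h : a.toList = (Bdry.pt d ⊠ Bdry.pt d').toList}
    (x : Lab N a) (i j k l : Fin N) (hx : x.flat = [i, j]) :
    (strands h).RT q N x (k, l) = if i = k ∧ j = l then 1 else 0 := by
  simp [RT, hx, Lab.flat]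

theorem RT_strands_nil {h : (Bdry.nil ⊠ Bdry.nil).toList = Bdry.nil.toList} (u : Lab N .nil) :
    (strands h).RT q N ((), ()) u = 1 := by
  simp [RT, Lab.flat]

theorem RT_par (i j k l : Fin N) :
    par.RT q N (i, j) (k, l) = if i = k ∧ j = l then 1 else 0 :=
  RT_strands_pair q _ i j k l rfl

theorem RT_cupcap (i j k l : Fin N) :
    cupcap.RT q N (i, j) (k, l) = if i = j ∧ k = l then quantumWeight q i else 0 := by
  refine (RT_cup_comp_eq q (RT_cap q .dn () k l)).trans ?_
  simp [cupWeight, capWeight, ite_and]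

theorem RT_sideCrossing_dn (ε : Bool) (i j k l : Fin N) :
    (sideCrossing ε .dn).RT q N (i, j) (k, l)
      = (quantumWeight q k)⁻¹ * quantumWeight q j * rMatrix q ε k i l j := by
  refine Eq.trans (RT_strands_comp_eq q ((), i, j) rfl <|
    RT_cap_tensor_idn_comp_eq q fun u => RT_strands_comp_eq q (u, (u, i), j) rfl <|
    RT_idn_tensor_pair_tensor_idn_comp_eq q (RT_crossing_dn q ε u i) fun x y =>
    RT_strands_comp_eq q ((u, x), (y, j)) rfl <|
    RT_idn_tensor_cup_comp_eq q <| RT_strands_pair q _ u x k l rfl) ?_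
  simp [capWeight, cupWeight, ite_and]
  ring

theorem RT_sideCrossing_up (ε : Bool) (i j k l : Fin N) :
    (sideCrossing ε .up).RT q N (i, j) (k, l) = rMatrix q ε j l i k := by
  refine Eq.trans (RT_strands_comp_eq q ((i, j), ()) rfl <|
    RT_idn_tensor_cap_comp_eq q fun u => RT_strands_comp_eq q (i, (j, u), u) rfl <|
    RT_idn_tensor_pair_tensor_idn_comp_eq q (RT_crossing_dn q ε j u) fun x y =>
    RT_strands_comp_eq q ((i, x), (y, u)) rfl <|
    RT_cup_tensor_idn_comp_eq q <| RT_strands_pair q _ y u k l rfl) ?_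
  simp [capWeight, cupWeight, ite_and]

theorem RT_lock_horizontal (i j k l : Fin N) (inv : Bool) :
    (Lock.tangle ⟨false, inv⟩).RT q N (i, j) (k, l)
      = ∑ x, ∑ y, (quantumWeight q x)⁻¹ * quantumWeight q j * rMatrix q (!inv) x i y j
          * rMatrix q (!inv) y l x k :=
  RT_pair_comp_eq q (RT_sideCrossing_dn q (!inv) i j) fun x y => RT_sideCrossing_up q (!inv) x y k l

theorem RT_lock_vertical (i j k l : Fin N) (inv : Bool) :
    (Lock.tangle ⟨true, inv⟩).RT q N (i, j) (k, l)
      = ∑ x, ∑ y, rMatrix q (!inv) i x k y * rMatrix q (!inv) l y j x * quantumWeight q y := by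
  refine Eq.trans (RT_strands_comp_eq q (i, (), j) rfl <|
    RT_idn_tensor_cap_tensor_idn_comp_eq q fun u => RT_strands_comp_eq q ((i, u), (u, j)) rfl <|
    RT_crossing_tensor_crossing_comp_eq q fun i' j' k' l' =>
    RT_strands_comp_eq q (i', (j', k'), l') rfl <|
    RT_idn_tensor_cup_tensor_idn_comp_eq q <| RT_strands_pair q _ i' l' k l rfl) ?_
  simp [capWeight, cupWeight, ite_and]

theorem RT_openClosure (X : Tangle (.dn ⊠ .up) (.dn ⊠ .up)) (u v : Lab N .nil) :
    (openClosure X).RT q N u v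
      = ∑ i : Fin N, ∑ k : Fin N, X.RT q N (i, i) (k, k) * quantumWeight q k := by
  refine (RT_cap_comp_eq q fun i => RT_comp_cup q .dn X v (i, i)).trans ?_
  simp only [capWeight, cupWeight, one_mul]
  rfl

theorem RT_closedClosure (X : Tangle (.dn ⊠ .up) (.dn ⊠ .up)) (u v : Lab N .nil) :
    (closedClosure X).RT q N u v
      = ∑ i : Fin N, ∑ j : Fin N,
        (quantumWeight q i)⁻¹ * (quantumWeight q j)⁻¹ * X.RT q N (i, j) (i, j) := by
  refine Eq.trans (RT_strands_comp_eq q ((), ()) rfl <|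
    RT_cap_tensor_cap_comp_eq q fun i j => RT_strands_comp_eq q (i, (i, j), j) rfl <|
    RT_idn_tensor_pair_tensor_idn_comp_eq q (fun _ _ => rfl) fun x y =>
    RT_strands_comp_eq q ((i, x), (y, j)) rfl <|
    RT_cup_tensor_cup_comp_eq q <| RT_strands_nil q v) ?_
  simp [capWeight, cupWeight]

theorem RT_precursorClosed {n : ℕ} (c : Fin n → Bool) (u v : Lab N .nil) :
    (precursorClosed c).RT q N u v
      = ∑ i : Fin N, ∑ j : Fin N, (quantumWeight q i)⁻¹ * quantumWeight q j
          * (parallelTwist n c).RT q N (i, j) (i, j) := by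
  refine Eq.trans (RT_strands_comp_eq q ((), ()) rfl <|
    RT_cap_tensor_cap_comp_eq q fun i j => RT_strands_comp_eq q (i, (i, j), j) rfl <|
    RT_idn_tensor_pair_tensor_idn_comp_eq q (fun _ _ => rfl) fun x y =>
    RT_strands_comp_eq q ((i, x), (y, j)) rfl <|
    RT_cup_tensor_cup_comp_eq q <| RT_strands_nil q v) ?_
  simp only [capWeight, cupWeight, mul_one, one_mul, mul_ite, mul_zero]
  simp only [Finset.sum_ite_eq, Finset.sum_ite_eq', Finset.sum_ite_irrel, Finset.sum_const_zero,
    Finset.mem_univ, if_true]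
  exact Finset.sum_congr rfl fun i _ => Finset.sum_congr rfl fun j _ => by ring

end Tangle

end StateSum

/-! ### Identities for the `R`-matrix -/

section RMatrix

theorem sum_ite_lt_telescope {K : Type*} [Field K] (g : ℕ → K) {N : ℕ} (m : Fin N) :
    ∑ c : Fin N, (if m < c then g (c + 1) - g c else 0) = g N - g (m + 1) := by
  have key : ∀ n, m.val + 1 ≤ n →
      ∑ c ∈ Finset.range n, (if m.val < c then g (c + 1) - g c else 0) = g n - g (m + 1) := by
    intro n hn
    induction n, hn using Nat.le_induction with
    | base =>
      rw [sub_self]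
      refine Finset.sum_eq_zero fun c hc => if_neg ?_
      have := Finset.mem_range.1 hc
      omega
    | succ n hn ih =>
      rw [Finset.sum_range_succ, ih, if_pos (by omega)]
      ring
  rw [← key N m.isLt, ← Fin.sum_univ_eq_sum_range fun c => if m.val < c then g (c + 1) - g c else 0]
  rfl

variable {K : Type*} [Field K] {q : K} {N : ℕ}

theorem quantumWeight_ne_zero (hq : q ≠ 0) (i : Fin N) : quantumWeight q i ≠ 0 :=
  zpow_ne_zero _ hq

theorem sub_inv_mul_quantumWeight (hq : q ≠ 0) (i : Fin N) :
    (q - q⁻¹) * quantumWeight q i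
      = q ^ (2 * ((i.val + 1 : ℕ) : ℤ) - N) - q ^ (2 * (i.val : ℤ) - N) := by
  rw [quantumWeight,
    show (2 * ((i.val + 1 : ℕ) : ℤ) - N) = 1 + (2 * (i.val : ℤ) + 1 - N) by push_cast; ring,
    show (2 * (i.val : ℤ) - N) = -1 + (2 * (i.val : ℤ) + 1 - N) by ring, zpow_add₀ hq,
    zpow_add₀ hq (-1), zpow_one, zpow_neg_one]
  ring

theorem sub_inv_mul_sum_quantumWeight (hq : q ≠ 0) :
    (q - q⁻¹) * ∑ i : Fin N, quantumWeight q i = q ^ N - (q ^ N)⁻¹ := by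
  rw [Finset.mul_sum]
  simp only [sub_inv_mul_quantumWeight hq]
  rw [Fin.sum_univ_eq_sum_range fun i => q ^ (2 * ((i + 1 : ℕ) : ℤ) - N) - q ^ (2 * (i : ℤ) - N),
    Finset.sum_range_sub fun i => q ^ (2 * (i : ℤ) - N)]
  rw [show 2 * (N : ℤ) - N = N by ring, zpow_natCast]
  simp

theorem sum_inv_quantumWeight :
    ∑ i : Fin N, (quantumWeight q i)⁻¹ = ∑ i : Fin N, quantumWeight q i := by
  rw [← Equiv.sum_comp Fin.revPerm]
  refine Finset.sum_congr rfl fun i _ => ?_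
  rw [quantumWeight, quantumWeight, ← zpow_neg]
  congr 1
  have := i.isLt
  simp only [Fin.revPerm_apply, Fin.val_rev]
  omega

theorem sub_inv_mul_sum_lt (hq : q ≠ 0) (m : Fin N) :
    (q - q⁻¹) * ∑ c : Fin N, (if m < c then quantumWeight q c else 0)
      = q ^ N - q * quantumWeight q m := by
  simp only [Finset.mul_sum, mul_ite, mul_zero, sub_inv_mul_quantumWeight hq]
  rw [sum_ite_lt_telescope (fun i => q ^ (2 * (i : ℤ) - N)) m, quantumWeight, ← zpow_one_add₀ hq,
    ← zpow_natCast]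
  congr 2 <;> push_cast <;> ring

theorem sub_inv_mul_sum_lt_inv (hq : q ≠ 0) (m : Fin N) :
    (q - q⁻¹) * ∑ c : Fin N, (if m < c then (quantumWeight q c)⁻¹ else 0)
      = q⁻¹ * (quantumWeight q m)⁻¹ - (q ^ N)⁻¹ := by
  have h : ∀ c : Fin N, (q - q⁻¹) * (quantumWeight q c)⁻¹
      = -q ^ ((N : ℤ) - 2 * ((c.val + 1 : ℕ) : ℤ)) - -q ^ ((N : ℤ) - 2 * (c.val : ℤ)) := by
    intro c
    rw [quantumWeight, ← zpow_neg,
      show ((N : ℤ) - 2 * ((c.val + 1 : ℕ) : ℤ)) = -1 + -(2 * (c.val : ℤ) + 1 - N) by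
        push_cast; ring,
      show ((N : ℤ) - 2 * (c.val : ℤ)) = 1 + -(2 * (c.val : ℤ) + 1 - N) by ring, zpow_add₀ hq,
      zpow_add₀ hq 1, zpow_one, zpow_neg_one]
    ring
  simp only [Finset.mul_sum, mul_ite, mul_zero, h]
  rw [sum_ite_lt_telescope (fun i => -q ^ ((N : ℤ) - 2 * (i : ℤ))) m, quantumWeight, ← mul_inv,
    ← zpow_one_add₀ hq, ← zpow_natCast, ← zpow_neg, ← zpow_neg, sub_neg_eq_add, neg_add_eq_sub]
  congr 2 <;> push_cast <;> ring

theorem rMatrix_true_mul_rMatrix_true (q : K) (i j k l x y : Fin N) :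
    rMatrix q true i x k y * rMatrix q true l y j x
      = (if y = i then if x = k then
            if i = j ∧ k = l then if i = k then q * q else 1 else 0 else 0 else 0)
        + if x = y then if i = k ∧ j = l then
            (if x = i then if l < i then q * (q - q⁻¹) else 0 else 0)
            + (if x = l then if i < l then q * (q - q⁻¹) else 0 else 0)
            + (if max i l < x then (q - q⁻¹) * (q - q⁻¹) else 0) else 0 else 0 := by
  generalize hz : q - q⁻¹ = z
  simp only [rMatrix, hz, if_true, max_lt_iff]
  grind

theorem rMatrix_false_mul_rMatrix_false (q : K) (i j k l x y : Fin N) :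
    rMatrix q false x i y j * rMatrix q false y l x k
      = (if y = i then if x = j then
            if i = k ∧ j = l then if i = j then q⁻¹ * q⁻¹ else 1 else 0 else 0 else 0)
        + if x = y then if i = j ∧ k = l then
            -(if x = i then if k < i then q⁻¹ * (q - q⁻¹) else 0 else 0)
            - (if x = k then if i < k then q⁻¹ * (q - q⁻¹) else 0 else 0)
            + (if max i k < x then (q - q⁻¹) * (q - q⁻¹) else 0) else 0 else 0 := by
  simp only [rMatrix, max_lt_iff, Bool.false_eq_true, if_false]
  generalize q - q⁻¹ = z
  generalize q⁻¹ = q'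
  grind

theorem sum_rMatrix_vertical (hq : q ≠ 0) (i j k l : Fin N) :
    ∑ x, ∑ y, rMatrix q true i x k y * rMatrix q true l y j x * quantumWeight q y
      = (if i = j ∧ k = l then quantumWeight q i else 0)
        + q ^ N * (q - q⁻¹) * (if i = k ∧ j = l then 1 else 0) := by
  have htail := sub_inv_mul_sum_lt hq (max i l)
  simp only [rMatrix_true_mul_rMatrix_true, add_mul, Finset.sum_add_distrib, ite_mul, zero_mul,
    Finset.sum_ite_eq, Finset.sum_ite_eq', Finset.mem_univ, if_true]
  by_cases h : i = k ∧ j = l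
  · have hs : ∑ x, (if max i l < x then (q - q⁻¹) * (q - q⁻¹) * quantumWeight q x else 0)
        = (q - q⁻¹) * (q ^ N - q * quantumWeight q (max i l)) := by
      rw [← htail, Finset.mul_sum, Finset.mul_sum]
      exact Finset.sum_congr rfl fun x _ => by split_ifs <;> ring
    obtain ⟨rfl, rfl⟩ := h
    simp only [and_self, if_true, Finset.sum_add_distrib, Finset.sum_ite_eq', Finset.mem_univ, hs]
    rcases lt_trichotomy i j with hij | rfl | hij
    · simp only [hij, hij.ne, hij.not_gt, max_eq_right hij.le, if_true, if_false]
      ring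
    · simp only [lt_irrefl, max_self, if_true, if_false]
      field_simp
      ring
    · simp only [hij, hij.ne', hij.not_gt, max_eq_left hij.le, if_true, if_false]
      ring
  · simp only [h, if_false, Finset.sum_const_zero, add_zero, mul_zero]
    grind

theorem sum_rMatrix_horizontal (hq : q ≠ 0) (i j k l : Fin N) :
    ∑ x, ∑ y, (quantumWeight q x)⁻¹ * quantumWeight q j * rMatrix q false x i y j
        * rMatrix q false y l x k
      = (if i = k ∧ j = l then 1 else 0)
        + -((q ^ N)⁻¹ * (q - q⁻¹)) * (if i = j ∧ k = l then quantumWeight q i else 0) := by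
  have htail := sub_inv_mul_sum_lt_inv hq (max i k)
  have hi := quantumWeight_ne_zero hq i
  have hj := quantumWeight_ne_zero hq j
  have hk := quantumWeight_ne_zero hq k
  have hA : q ^ N ≠ 0 := pow_ne_zero _ hq
  simp only [mul_assoc _ (rMatrix _ _ _ _ _ _), rMatrix_false_mul_rMatrix_false, mul_add,
    Finset.sum_add_distrib, mul_ite, mul_zero,
    Finset.sum_ite_eq, Finset.sum_ite_eq', Finset.mem_univ, if_true]
  by_cases h : i = j ∧ k = l
  · have hs : ∑ x, (if max i k < x then
          (quantumWeight q x)⁻¹ * quantumWeight q j * ((q - q⁻¹) * (q - q⁻¹)) else 0)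
        = quantumWeight q j * ((q - q⁻¹) *
          (q⁻¹ * (quantumWeight q (max i k))⁻¹ - (q ^ N)⁻¹)) := by
      rw [← htail, Finset.mul_sum, Finset.mul_sum, Finset.mul_sum]
      exact Finset.sum_congr rfl fun x _ => by split_ifs <;> ring
    obtain ⟨rfl, rfl⟩ := h
    simp only [and_self, if_true, mul_sub, mul_neg, mul_ite, mul_zero, Finset.sum_add_distrib,
      Finset.sum_sub_distrib, Finset.sum_neg_distrib, Finset.sum_ite_eq', Finset.mem_univ] at hs ⊢
    rw [hs]
    rcases lt_trichotomy i k with hik | rfl | hik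
    · simp only [hik, hik.ne, hik.not_gt, max_eq_right hik.le, if_true, if_false]
      field_simp
      ring
    · simp only [lt_irrefl, max_self, if_true, if_false]
      field_simp
      ring
    · simp only [hik, hik.ne', hik.not_gt, max_eq_left hik.le, if_true, if_false]
      field_simp
      ring
  · simp only [h, if_false, Finset.sum_const_zero, add_zero]
    split_ifs <;> first | rfl | (exfalso; grind) | simp_all

end RMatrix

/-! ### State sums of chains of locks and of their closures -/

section Chain

variable {K : Type*} [Field K] {q : K} {N : ℕ}

namespace Tangle

theorem RT_lock_vertical_eq (hq : q ≠ 0) :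
    (Lock.tangle ⟨true, false⟩).RT q N
      = cupcap.RT q N + (q ^ N * (q - q⁻¹)) • par.RT q N := by
  ext ⟨i, j⟩ ⟨k, l⟩
  refine ((RT_lock_vertical q i j k l false).trans (sum_rMatrix_vertical hq i j k l)).trans ?_
  exact (congrArg₂ (fun x y => x + q ^ N * (q - q⁻¹) * y) (RT_cupcap q i j k l)
    (RT_par q i j k l)).symm

theorem RT_lock_inverse_horizontal_eq (hq : q ≠ 0) :
    (Lock.tangle ⟨false, true⟩).RT q N
      = par.RT q N + (-((q ^ N)⁻¹ * (q - q⁻¹))) • cupcap.RT q N := by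
  ext ⟨i, j⟩ ⟨k, l⟩
  refine ((RT_lock_horizontal q i j k l true).trans (sum_rMatrix_horizontal hq i j k l)).trans ?_
  exact (congrArg₂ (fun x y => x + -((q ^ N)⁻¹ * (q - q⁻¹)) * y) (RT_par q i j k l)
    (RT_cupcap q i j k l)).symm

theorem RT_par_eq_one [DecidableEq (Lab N (.dn ⊠ .up))] : par.RT q N = 1 := by
  ext x y
  rw [Matrix.one_apply]
  exact RT_idn q x y

theorem RT_cupcap_mul_self :
    cupcap.RT q N * cupcap.RT q N = (∑ i : Fin N, quantumWeight q i) • cupcap.RT q N := by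
  ext ⟨i, j⟩ ⟨k, l⟩
  refine (RT_pair_comp_eq q (RT_cupcap q i j) fun x y => RT_cupcap q x y k l).trans ?_
  refine Eq.trans ?_ (congrArg ((∑ i : Fin N, quantumWeight q i) * ·) (RT_cupcap q i j k l)).symm
  by_cases h : i = j <;> by_cases h' : k = l <;>
    simp [h, h', ← Finset.mul_sum, mul_comm]

end Tangle

theorem combination_mul_combination {A : Type*} [Ring A] [Algebra K A] {C : A} {D : K}
    (hC : C * C = D • C) (a b c d : K) :
    (a • (1 : A) + b • C) * (c • (1 : A) + d • C)
      = (a * c) • (1 : A) + (a * d + b * c + b * d * D) • C := by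
  simp only [add_mul, mul_add, smul_mul_smul_comm, one_mul, mul_one, hC]
  module

/-- A chain of tangles each of which is a combination of `||` and the cup-cap. -/
theorem RT_chainTangle {D : K} (hD : D ≠ 0) (hδ : ∑ i : Fin N, quantumWeight q i = D) :
    ∀ {n : ℕ} (v : Fin n → Lock) (α γ : Fin n → K)
      (_ : ∀ i, (v i).tangle.RT q N = α i • Tangle.par.RT q N + γ i • Tangle.cupcap.RT q N),
      (chainTangle n v).RT q N = (∏ i, α i) • Tangle.par.RT q N
        + ((∏ i, (α i + γ i * D) - ∏ i, α i) / D) • Tangle.cupcap.RT q N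
  | 0, v, α, γ, _ => by
    simp [chainTangle]
  | n + 1, v, α, γ, h => by
    classical
    have hrec : (chainTangle (n + 1) v).RT q N
        = (v 0).tangle.RT q N * (chainTangle n (Fin.tail v)).RT q N := rfl
    rw [hrec, h 0, RT_chainTangle hD hδ (Fin.tail v) (Fin.tail α) (Fin.tail γ) fun i => h i.succ,
      Tangle.RT_par_eq_one, Fin.prod_univ_succ, Fin.prod_univ_succ]
    refine (combination_mul_combination (Tangle.RT_cupcap_mul_self.trans (by rw [hδ]))
      _ _ _ _).trans ?_
    congr 2
    simp only [Fin.tail]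
    generalize ∏ i : Fin n, (α i.succ + γ i.succ * D) = p
    field_simp
    ring

theorem RT_chainTangle_hypercubeVertex (hq : q ≠ 0) {D : K} (hD : D ≠ 0)
    (hδ : ∑ i : Fin N, quantumWeight q i = D) {n : ℕ} (S : Finset (Fin n)) :
    (chainTangle n (hypercubeVertex S)).RT q N
      = (q ^ N * (q - q⁻¹)) ^ S.card • Tangle.par.RT q N
        + Theta (q ^ N * (q - q⁻¹)) (-((q ^ N)⁻¹ * (q - q⁻¹))) D n S.card
          • Tangle.cupcap.RT q N := by
  set φ := q ^ N * (q - q⁻¹) with hφ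
  set φbar := -((q ^ N)⁻¹ * (q - q⁻¹)) with hφbar
  rw [RT_chainTangle hD hδ _ (fun i => (hypercubeVertex S i).weight φ φbar .par)
    fun i => (hypercubeVertex S i).weight φ φbar .cupcap]
  · rw [prod_weight_par, prod_hypercubeVertex S fun t =>
      t.weight φ φbar .par + t.weight φ φbar .cupcap * D]
    simp [Lock.weight, Theta, add_comm]
  · intro i
    rw [hypercubeVertex]
    split_ifs
    · rw [Tangle.RT_lock_vertical_eq hq, add_comm]
      simp [Lock.weight, hφ]
    · rw [Tangle.RT_lock_inverse_horizontal_eq hq]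
      simp [Lock.weight, hφbar]

theorem RT_openClosure_eq {D : K} (hδ : ∑ i : Fin N, quantumWeight q i = D)
    {X : Tangle (.dn ⊠ .up) (.dn ⊠ .up)} {a b : K}
    (hX : X.RT q N = a • Tangle.par.RT q N + b • Tangle.cupcap.RT q N) (u v : Lab N .nil) :
    (openClosure X).RT q N u v = a * D + b * D ^ 2 := by
  have h : ∀ i k : Fin N, X.RT q N (i, i) (k, k)
      = a * (if i = k ∧ i = k then 1 else 0)
        + b * (if i = i ∧ k = k then quantumWeight q i else 0) := fun i k =>
    (congrFun (congrFun hX (i, i)) (k, k)).trans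
      (congrArg₂ (fun x y => a * x + b * y) (Tangle.RT_par q i i k k) (Tangle.RT_cupcap q i i k k))
  rw [Tangle.RT_openClosure]
  simp only [h, add_mul, Finset.sum_add_distrib]
  simp only [and_self, mul_ite, mul_zero, mul_one, ite_mul, zero_mul, Finset.sum_ite_eq,
    Finset.mem_univ, if_true, ← Finset.mul_sum, ← Finset.sum_mul, hδ]
  ring

theorem RT_closedClosure_eq (hq : q ≠ 0) {D : K} (hδ : ∑ i : Fin N, quantumWeight q i = D)
    {X : Tangle (.dn ⊠ .up) (.dn ⊠ .up)} {a b : K}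
    (hX : X.RT q N = a • Tangle.par.RT q N + b • Tangle.cupcap.RT q N) (u v : Lab N .nil) :
    (closedClosure X).RT q N u v = a * D ^ 2 + b * D := by
  have h : ∀ i j : Fin N, X.RT q N (i, j) (i, j)
      = a * (if i = i ∧ j = j then 1 else 0)
        + b * (if i = j ∧ i = j then quantumWeight q i else 0) := fun i j =>
    (congrFun (congrFun hX (i, j)) (i, j)).trans
      (congrArg₂ (fun x y => a * x + b * y) (Tangle.RT_par q i j i j) (Tangle.RT_cupcap q i j i j))
  have hδ' : ∑ i : Fin N, (quantumWeight q i)⁻¹ = D := sum_inv_quantumWeight.trans hδ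
  have hw : ∀ i : Fin N, (quantumWeight q i)⁻¹ * (quantumWeight q i)⁻¹ * (b * quantumWeight q i)
      = b * (quantumWeight q i)⁻¹ := fun i => by
    have := quantumWeight_ne_zero hq i
    field_simp
  rw [Tangle.RT_closedClosure]
  simp only [h, mul_add, Finset.sum_add_distrib]
  simp only [and_self, mul_ite, mul_zero, mul_one, Finset.sum_ite_eq, Finset.mem_univ, if_true, hw,
    ← Finset.mul_sum, ← Finset.sum_mul, hδ']
  ring

theorem writhe_chainTangle : ∀ {n : ℕ} (v : Fin n → Lock),
    (chainTangle n v).writhe = ∑ i, (v i).tangle.writhe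
  | 0, _ => rfl
  | n + 1, v => by
    rw [Fin.sum_univ_succ, chainTangle, Tangle.writhe, writhe_chainTangle]
    rfl

theorem writhe_chainTangle_hypercubeVertex {n : ℕ} (S : Finset (Fin n)) :
    (chainTangle n (hypercubeVertex S)).writhe
      = 2 * (S.card : ℤ) - 2 * ((n - S.card : ℕ) : ℤ) := by
  rw [writhe_chainTangle, sum_hypercubeVertex S fun t => t.tangle.writhe]
  have h₁ : (Lock.tangle ⟨true, false⟩).writhe = 2 := rfl
  have h₂ : (Lock.tangle ⟨false, true⟩).writhe = -2 := rfl
  rw [h₁, h₂, nsmul_eq_mul, nsmul_eq_mul]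
  ring

theorem writhe_openClosure (X : Tangle (.dn ⊠ .up) (.dn ⊠ .up)) :
    (openClosure X).writhe = X.writhe := by
  change 0 + (X.writhe + 0) = X.writhe
  ring

theorem writhe_closedClosure (X : Tangle (.dn ⊠ .up) (.dn ⊠ .up)) :
    (closedClosure X).writhe = X.writhe := by
  simp [closedClosure, Tangle.writhe]

end Chain

/-! ### The field `ℚ(q)` and the specialisations `A = q ^ N` -/

section Specialisation

theorem qq_ne_zero : qq ≠ 0 := RatFunc.X_ne_zero

theorem qq_pow_ne_one {N : ℕ} (hN : N ≠ 0) : qq ^ N ≠ 1 := fun h =>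
  hN (qq_pow_injective (h.trans (pow_zero qq).symm))

theorem sub_inv_ne_zero_of_sq_ne_one {K : Type*} [Field K] {x : K} (hx : x ≠ 0) (h : x ^ 2 ≠ 1) :
    x - x⁻¹ ≠ 0 := by
  intro h'
  apply h
  field_simp at h'
  linear_combination h'

theorem qq_sub_inv_ne_zero : qq - qq⁻¹ ≠ 0 :=
  sub_inv_ne_zero_of_sq_ne_one qq_ne_zero (qq_pow_ne_one two_ne_zero)

theorem qq_add_inv_ne_zero : qq + qq⁻¹ ≠ 0 := by
  intro h
  have h' : qq ^ 2 = -1 := by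
    have hq := qq_ne_zero
    field_simp at h
    linear_combination h
  exact qq_pow_ne_one four_ne_zero (by linear_combination (qq ^ 2 - 1) * h')

theorem specA_T (N : ℕ) (m : ℤ) : specA N (LaurentPolynomial.T m) = (qq ^ N) ^ m := by
  rw [specA, LaurentPolynomial.eval₂_T]
  simp [qUnit, qq]

theorem specA_C (N : ℕ) (a : RatFunc ℚ) : specA N (LaurentPolynomial.C a) = a := by
  rw [specA, LaurentPolynomial.eval₂_C, RingHom.id_apply]

theorem specA_homPhi (N : ℕ) : specA N homPhi = qq ^ N * (qq - qq⁻¹) := by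
  rw [homPhi, map_mul, specA_T, specA_C, zpow_one]

theorem specA_homPhiBar (N : ℕ) : specA N homPhiBar = -((qq ^ N)⁻¹ * (qq - qq⁻¹)) := by
  rw [homPhiBar, map_neg, map_mul, specA_T, specA_C, zpow_neg_one]

theorem specA_homD (N : ℕ) : specA N homD = ∑ i : Fin N, quantumWeight qq i := by
  rw [homD, map_mul, map_sub, specA_T, specA_T, specA_C, zpow_one, zpow_neg_one,
    inv_mul_eq_iff_eq_mul₀ qq_sub_inv_ne_zero, sub_inv_mul_sum_quantumWeight qq_ne_zero]

theorem specA_homD_ne_zero {N : ℕ} (hN : 1 ≤ N) : specA N homD ≠ 0 := by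
  rw [homD, map_mul, map_sub, specA_T, specA_T, specA_C, zpow_one, zpow_neg_one]
  refine mul_ne_zero (inv_ne_zero qq_sub_inv_ne_zero)
    (sub_inv_ne_zero_of_sq_ne_one (pow_ne_zero _ qq_ne_zero) ?_)
  rw [← pow_mul]
  exact qq_pow_ne_one (by omega)

theorem RT_chainTangle_qq {N : ℕ} (hN : 1 ≤ N) {n : ℕ} (S : Finset (Fin n)) :
    (chainTangle n (hypercubeVertex S)).RT qq N
      = specA N homPhi ^ S.card • Tangle.par.RT qq N
        + Theta (specA N homPhi) (specA N homPhiBar) (specA N homD) n S.card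
          • Tangle.cupcap.RT qq N := by
  rw [specA_homPhi, specA_homPhiBar]
  exact RT_chainTangle_hypercubeVertex qq_ne_zero (specA_homD_ne_zero hN) (specA_homD N).symm S

theorem specA_T_eq_writhe {n : ℕ} (S : Finset (Fin n)) (N : ℕ) :
    specA N (LaurentPolynomial.T (2 * (n : ℤ) - 4 * S.card))
      = (qq ^ N) ^ (-(chainTangle n (hypercubeVertex S)).writhe) := by
  have hS : S.card ≤ n := by simpa using S.card_le_univ
  rw [specA_T, writhe_chainTangle_hypercubeVertex, Nat.cast_sub hS]
  congr 1
  ring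

theorem isHOMFLY_openClosure {n : ℕ} (S : Finset (Fin n)) :
    IsHOMFLY (openClosure (chainTangle n (hypercubeVertex S)))
      (LaurentPolynomial.T (2 * (n : ℤ) - 4 * S.card)
        * (homD * (homD + homPhi) ^ S.card * (1 + homPhiBar * homD) ^ (n - S.card))) := by
  intro N hN
  rw [LinkDiagram.slN, writhe_openClosure,
    RT_openClosure_eq (specA_homD N).symm (RT_chainTangle_qq hN S), map_mul, specA_T_eq_writhe]
  simp only [map_mul, map_add, map_pow, map_one]
  linear_combination -(qq ^ N) ^ (-(chainTangle n (hypercubeVertex S)).writhe) * specA N homD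
    * Theta_mul_self (φ := specA N homPhi) (φbar := specA N homPhiBar) (specA_homD_ne_zero hN)
      n S.card

theorem isHOMFLY_closedClosure {n : ℕ} (S : Finset (Fin n)) :
    IsHOMFLY (closedClosure (chainTangle n (hypercubeVertex S)))
      (LaurentPolynomial.T (2 * (n : ℤ) - 4 * S.card)
        * ((homD + homPhi) ^ S.card * (1 + homPhiBar * homD) ^ (n - S.card)
          + homPhi ^ S.card * (homD ^ 2 - 1))) := by
  intro N hN
  rw [LinkDiagram.slN, writhe_closedClosure,
    RT_closedClosure_eq qq_ne_zero (specA_homD N).symm (RT_chainTangle_qq hN S), map_mul,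
    specA_T_eq_writhe]
  simp only [map_mul, map_add, map_sub, map_pow, map_one]
  linear_combination -(qq ^ N) ^ (-(chainTangle n (hypercubeVertex S)).writhe)
    * Theta_mul_self (φ := specA N homPhi) (φbar := specA N homPhiBar) (specA_homD_ne_zero hN)
      n S.card

end Specialisation

/-! ### Integrality -/

section Integrality

/-- Divisibility behind the integrality of the open closure. -/
theorem exists_pow_eq_add {R : Type*} [CommRing R] {A A' z : R} (hA : A * A' = 1) (k : ℕ) :
    ∃ F : R, (A' ^ 2 * (A - A') + A' * z ^ 2) ^ k
      = (A - A') ^ k + ((A - A') ^ 2 - z ^ 2) * F := by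
  obtain ⟨F, hF⟩ := sub_dvd_pow_sub_pow (A' ^ 2 * (A - A') + A' * z ^ 2) (A - A') k
  refine ⟨-A' * F, ?_⟩
  have h : A' ^ 2 * (A - A') + A' * z ^ 2 - (A - A') = -A' * ((A - A') ^ 2 - z ^ 2) := by
    linear_combination (A - A') * hA
  rw [h] at hF
  linear_combination hF

theorem exists_pow_add_eq_add {R : Type*} [CommRing R] {A A' z : R} (hA : A * A' = 1) (m d : ℕ) :
    ∃ F : R, (A' ^ 2 * (A - A') + A' * z ^ 2) ^ (m + 1)
        + A ^ (2 * d) * A' ^ (m + 1) * z ^ (2 * m) * ((A - A') ^ 2 - z ^ 2)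
      = (A - A') ^ (m + 1) + (A - A') * ((A - A') ^ 2 - z ^ 2) * F := by
  set b := A - A' with hb
  set a := A' ^ 2 * b + A' * z ^ 2 with ha
  have hab : a - b = -A' * (b ^ 2 - z ^ 2) := by
    rw [ha, hb]
    linear_combination (A - A') * hA
  have hgeom := (Commute.all a b).geom_sum₂_mul (m + 1)
  have hsum : b ∣ (∑ i ∈ Finset.range (m + 1), a ^ i * b ^ (m + 1 - 1 - i)) - a ^ m := by
    rw [Finset.sum_range_succ, Nat.add_sub_cancel, Nat.sub_self, pow_zero, mul_one,
      add_sub_cancel_right]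
    refine Finset.dvd_sum fun i hi => Dvd.dvd.mul_left (dvd_pow_self _ ?_) _
    have := Finset.mem_range.1 hi
    omega
  obtain ⟨G₁, hG₁⟩ := hsum
  have hpow : b ∣ a ^ m - (A' * z ^ 2) ^ m :=
    Dvd.dvd.trans ⟨A' ^ 2, by rw [ha]; ring⟩ (sub_dvd_pow_sub_pow a (A' * z ^ 2) m)
  obtain ⟨G₂, hG₂⟩ := hpow
  have hunit : b ∣ A ^ (2 * d) - 1 := by
    have h := sub_dvd_pow_sub_pow (A ^ 2) 1 d
    rw [one_pow, ← pow_mul] at h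
    exact Dvd.dvd.trans ⟨A, by rw [hb]; linear_combination hA⟩ h
  obtain ⟨G₃, hG₃⟩ := hunit
  refine ⟨-A' * (G₁ + G₂) + A' ^ (m + 1) * z ^ (2 * m) * G₃, ?_⟩
  have hgeom' : a ^ (m + 1) - b ^ (m + 1)
      = -A' * (b ^ 2 - z ^ 2) * ((A' * z ^ 2) ^ m + b * G₂ + b * G₁) := by
    rw [← hgeom, hab, sub_eq_iff_eq_add.1 hG₁, sub_eq_iff_eq_add.1 hG₂]
    ring
  have hz : A' * (A' * z ^ 2) ^ m = A' ^ (m + 1) * z ^ (2 * m) := by ring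
  linear_combination hgeom' - (b ^ 2 - z ^ 2) * hz
    + A' ^ (m + 1) * z ^ (2 * m) * (b ^ 2 - z ^ 2) * hG₃

theorem fromInt_T_one : fromInt (LaurentPolynomial.T 1) = LaurentPolynomial.T 1 := by
  rw [fromInt, LaurentPolynomial.eval₂_T, zpow_one]
  rfl

theorem T_one_mul_T_neg_one (R : Type*) [CommSemiring R] :
    (LaurentPolynomial.T 1 : R[T;T⁻¹]) * LaurentPolynomial.T (-1) = 1 := by
  rw [← LaurentPolynomial.T_add, add_neg_cancel, LaurentPolynomial.T_zero]

theorem fromInt_T_neg_one : fromInt (LaurentPolynomial.T (-1)) = LaurentPolynomial.T (-1) := by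
  have h := congrArg fromInt (T_one_mul_T_neg_one ℤ[T;T⁻¹])
  rw [map_mul, map_one, fromInt_T_one] at h
  linear_combination LaurentPolynomial.T (-1) * h
    - fromInt (LaurentPolynomial.T (-1)) * T_one_mul_T_neg_one (RatFunc ℚ)

theorem fromInt_C_T (m : ℤ) :
    fromInt (LaurentPolynomial.C (LaurentPolynomial.T m)) = LaurentPolynomial.C (qq ^ m) := by
  rw [fromInt, LaurentPolynomial.eval₂_C, RingHom.comp_apply, LaurentPolynomial.eval₂_T]
  simp [qUnit, qq]

theorem fromInt_C_brace :
    fromInt (LaurentPolynomial.C (LaurentPolynomial.T 1 - LaurentPolynomial.T (-1)))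
      = LaurentPolynomial.C (qq - qq⁻¹) := by
  rw [map_sub, map_sub, fromInt_C_T, fromInt_C_T, zpow_one, zpow_neg_one, map_sub]

theorem C_mul_C_inv {x : RatFunc ℚ} (hx : x ≠ 0) :
    (LaurentPolynomial.C x : (RatFunc ℚ)[T;T⁻¹]) * LaurentPolynomial.C x⁻¹ = 1 := by
  rw [← map_mul, mul_inv_cancel₀ hx, map_one]

theorem braceAqAq_eq : braceAqAq = braceA ^ 2 - LaurentPolynomial.C (qq - qq⁻¹) ^ 2 := by
  have hA := T_one_mul_T_neg_one (RatFunc ℚ)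
  have hq := C_mul_C_inv qq_ne_zero
  rw [braceAqAq, braceA, map_sub]
  linear_combination
    (2 - LaurentPolynomial.C qq ^ 2 - LaurentPolynomial.C qq⁻¹ ^ 2) * hA
      + (LaurentPolynomial.T 1 ^ 2 + LaurentPolynomial.T (-1) ^ 2 - 2) * hq

theorem one_add_homPhiBar_mul_homD :
    1 + homPhiBar * homD = LaurentPolynomial.T (-1) ^ 2 := by
  rw [homPhiBar, homD]
  linear_combination
    -(LaurentPolynomial.T (-1) * (LaurentPolynomial.T 1 - LaurentPolynomial.T (-1)))
      * C_mul_C_inv qq_sub_inv_ne_zero - T_one_mul_T_neg_one (RatFunc ℚ)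

theorem T_two_mul_sub (d k : ℕ) : (LaurentPolynomial.T (2 * ((k + d : ℕ) : ℤ) - 4 * k) :
    (RatFunc ℚ)[T;T⁻¹]) = LaurentPolynomial.T 1 ^ (2 * d) * LaurentPolynomial.T (-1) ^ (2 * k) := by
  rw [LaurentPolynomial.T_pow, LaurentPolynomial.T_pow, ← LaurentPolynomial.T_add]
  congr 1
  push_cast
  ring

theorem T_neg_two_mul (k : ℕ) : (LaurentPolynomial.T (-2 * (k : ℤ)) : (RatFunc ℚ)[T;T⁻¹])
    = LaurentPolynomial.T (-1) ^ (2 * k) := by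
  rw [LaurentPolynomial.T_pow]
  congr 1
  push_cast
  ring

theorem T_mul_one_add_pow (d k : ℕ) :
    LaurentPolynomial.T (2 * ((k + d : ℕ) : ℤ) - 4 * k) * (1 + homPhiBar * homD) ^ d
      = LaurentPolynomial.T (-1) ^ (2 * k) := by
  have h : (LaurentPolynomial.T 1 : (RatFunc ℚ)[T;T⁻¹]) ^ (2 * d)
      * LaurentPolynomial.T (-1) ^ (2 * d) = 1 := by
    rw [← mul_pow, T_one_mul_T_neg_one, one_pow]
  rw [T_two_mul_sub, one_add_homPhiBar_mul_homD, ← pow_mul]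
  linear_combination LaurentPolynomial.T (-1) ^ (2 * k) * h

theorem homD_eq : homD = LaurentPolynomial.C (qq - qq⁻¹)⁻¹ * braceA := rfl

theorem T_neg_two_mul_homD_add_homPhi_pow (k : ℕ) :
    LaurentPolynomial.T (-1) ^ (2 * k) * (homD + homPhi) ^ k
      = LaurentPolynomial.C (qq - qq⁻¹)⁻¹ ^ k * (LaurentPolynomial.T (-1) ^ 2 * braceA
        + LaurentPolynomial.T (-1) * LaurentPolynomial.C (qq - qq⁻¹) ^ 2) ^ k := by
  rw [pow_mul, ← mul_pow, ← mul_pow, homD_eq, homPhi]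
  congr 1
  linear_combination LaurentPolynomial.T (-1) * LaurentPolynomial.C (qq - qq⁻¹)
      * T_one_mul_T_neg_one (RatFunc ℚ)
    - LaurentPolynomial.T (-1) * LaurentPolynomial.C (qq - qq⁻¹)
      * C_mul_C_inv qq_sub_inv_ne_zero

theorem HOMFLY_openClosure_eq {n k : ℕ} (hk : k ≤ n) :
    LaurentPolynomial.T (2 * (n : ℤ) - 4 * k)
        * (homD * (homD + homPhi) ^ k * (1 + homPhiBar * homD) ^ (n - k))
      = LaurentPolynomial.T (-2 * (k : ℤ)) * (homD * (homD + homPhi) ^ k) := by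
  obtain ⟨d, rfl⟩ := Nat.exists_eq_add_of_le hk
  rw [Nat.add_sub_cancel_left, T_neg_two_mul, ← T_mul_one_add_pow d k]
  ring

theorem exists_integral_openClosure (k : ℕ) : ∃ F : ℤ[T;T⁻¹][T;T⁻¹],
    braceA ^ k * (LaurentPolynomial.T (-2 * (k : ℤ)) * (homD * (homD + homPhi) ^ k))
      = homD ^ (k + 1) * (braceA ^ k + braceAqAq * fromInt F) := by
  obtain ⟨F, hF⟩ := exists_pow_eq_add (T_one_mul_T_neg_one ℤ[T;T⁻¹])
    (z := LaurentPolynomial.C (LaurentPolynomial.T 1 - LaurentPolynomial.T (-1))) k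
  refine ⟨F, ?_⟩
  have hF' := congrArg fromInt hF
  simp only [map_add, map_mul, map_pow, map_sub fromInt, fromInt_T_one, fromInt_T_neg_one,
    fromInt_C_brace] at hF'
  rw [← braceA, ← braceAqAq_eq] at hF'
  rw [T_neg_two_mul]
  have h := T_neg_two_mul_homD_add_homPhi_pow k
  rw [hF'] at h
  have hD : homD ^ (k + 1) = LaurentPolynomial.C (qq - qq⁻¹)⁻¹ ^ k * braceA ^ k * homD := by
    rw [pow_succ, homD_eq, mul_pow]
  rw [hD]
  linear_combination braceA ^ k * homD * h

theorem exists_integral_closedClosure {n k : ℕ} (hk : k ≤ n) (hk₁ : 1 ≤ k) :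
    ∃ F : ℤ[T;T⁻¹][T;T⁻¹],
      braceA ^ (k - 1) * (LaurentPolynomial.T (2 * (n : ℤ) - 4 * k)
          * ((homD + homPhi) ^ k * (1 + homPhiBar * homD) ^ (n - k) + homPhi ^ k * (homD ^ 2 - 1)))
        = homD ^ k * (braceA ^ (k - 1) + braceAqAq * fromInt F) := by
  obtain ⟨d, rfl⟩ := Nat.exists_eq_add_of_le hk
  obtain ⟨m, rfl⟩ := Nat.exists_eq_add_of_le' hk₁
  obtain ⟨F, hF⟩ := exists_pow_add_eq_add (T_one_mul_T_neg_one ℤ[T;T⁻¹])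
    (z := LaurentPolynomial.C (LaurentPolynomial.T 1 - LaurentPolynomial.T (-1))) m d
  refine ⟨F, ?_⟩
  have hF' := congrArg fromInt hF
  simp only [map_add, map_mul, map_pow, map_sub fromInt, fromInt_T_one, fromInt_T_neg_one,
    fromInt_C_brace] at hF'
  rw [← braceA, ← braceAqAq_eq] at hF'
  have h := T_neg_two_mul_homD_add_homPhi_pow (m + 1)
  have hT := T_mul_one_add_pow d (m + 1)
  have hA : (LaurentPolynomial.T 1 : (RatFunc ℚ)[T;T⁻¹]) ^ (m + 1)
      * LaurentPolynomial.T (-1) ^ (m + 1) = 1 := by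
    rw [← mul_pow, T_one_mul_T_neg_one, one_pow]
  have hz := C_mul_C_inv qq_sub_inv_ne_zero
  have hzm : (LaurentPolynomial.C (qq - qq⁻¹) : (RatFunc ℚ)[T;T⁻¹]) ^ m
      * LaurentPolynomial.C (qq - qq⁻¹)⁻¹ ^ m = 1 := by
    rw [← mul_pow, hz, one_pow]
  have hφ : LaurentPolynomial.T (2 * ((m + 1 + d : ℕ) : ℤ) - 4 * (m + 1 : ℕ))
        * (homPhi ^ (m + 1) * (homD ^ 2 - 1))
      = LaurentPolynomial.C (qq - qq⁻¹)⁻¹ ^ (m + 1)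
        * (LaurentPolynomial.T 1 ^ (2 * d) * LaurentPolynomial.T (-1) ^ (m + 1)
          * LaurentPolynomial.C (qq - qq⁻¹) ^ (2 * m) * braceAqAq) := by
    rw [T_two_mul_sub, homPhi, homD_eq, braceAqAq_eq]
    generalize (LaurentPolynomial.T 1 : (RatFunc ℚ)[T;T⁻¹]) = A at *
    generalize (LaurentPolynomial.T (-1) : (RatFunc ℚ)[T;T⁻¹]) = A' at *
    generalize (LaurentPolynomial.C (qq - qq⁻¹) : (RatFunc ℚ)[T;T⁻¹]) = z at *
    generalize (LaurentPolynomial.C (qq - qq⁻¹)⁻¹ : (RatFunc ℚ)[T;T⁻¹]) = z' at *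
    have h₁ : z ^ (m + 1) * ((z' * braceA) ^ 2 - 1)
        = z' ^ (m + 1) * z ^ (2 * m) * (braceA ^ 2 - z ^ 2) := by
      have e₁ : z ^ (m + 1) * z' ^ 2 = z' ^ (m + 1) * z ^ (2 * m) := by
        linear_combination z ^ m * z' * hz - z ^ m * z' * hzm
      have e₂ : z ^ (m + 1) = z' ^ (m + 1) * z ^ (2 * m) * z ^ 2 := by
        linear_combination -z ^ (m + 1) * hzm - z ^ (2 * m + 1) * z' ^ m * hz
      linear_combination braceA ^ 2 * e₁ - e₂
    linear_combination A ^ (2 * d) * A' ^ (m + 1) * hA * z ^ (m + 1) * ((z' * braceA) ^ 2 - 1)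
      + A ^ (2 * d) * A' ^ (m + 1) * h₁
  rw [Nat.add_sub_cancel_left, Nat.add_sub_cancel, mul_add, hφ, homD_eq]
  have h' : LaurentPolynomial.T (2 * ((m + 1 + d : ℕ) : ℤ) - 4 * (m + 1 : ℕ))
        * ((LaurentPolynomial.C (qq - qq⁻¹)⁻¹ * braceA + homPhi) ^ (m + 1)
          * (1 + homPhiBar * (LaurentPolynomial.C (qq - qq⁻¹)⁻¹ * braceA)) ^ d)
      = LaurentPolynomial.C (qq - qq⁻¹)⁻¹ ^ (m + 1) * (LaurentPolynomial.T (-1) ^ 2 * braceA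
        + LaurentPolynomial.T (-1) * LaurentPolynomial.C (qq - qq⁻¹) ^ 2) ^ (m + 1) := by
    rw [← homD_eq, ← h]
    linear_combination (homD + homPhi) ^ (m + 1) * hT
  rw [h']
  linear_combination braceA ^ m * LaurentPolynomial.C (qq - qq⁻¹)⁻¹ ^ (m + 1) * hF'

end Integrality

/-! ### Precursors and their Jones polynomials -/

section Jones

theorem precursor_hypercubeVertex {n : ℕ} (S : Finset (Fin n)) :
    precursor (hypercubeVertex S) = fun _ => true := by
  funext i
  rw [precursor, hypercubeVertex]
  split_ifs <;> rfl

theorem writhe_parallelTwist : ∀ n : ℕ, (parallelTwist n fun _ => true).writhe = n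
  | 0 => rfl
  | n + 1 => by
    have h : (parallelTwist (n + 1) fun _ => true).writhe
        = 1 + (parallelTwist n fun _ => true).writhe := rfl
    rw [h, writhe_parallelTwist n]
    push_cast
    ring

theorem writhe_precursorClosed (n : ℕ) :
    Tangle.writhe (precursorClosed fun _ : Fin n => true) = n := by
  simp [precursorClosed, Tangle.writhe, writhe_parallelTwist]

theorem writhe_sideCrossing_false : ∀ d : Dir, (Tangle.sideCrossing false d).writhe = -1
  | .dn => rfl
  | .up => rfl

theorem writhe_antiparallelTwist : ∀ (n : ℕ) (d : Dir),
    (antiparallelTwist n (fun _ => true) d).writhe = -n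
  | 0, .dn => rfl
  | 0, .up => rfl
  | n + 1, d => by
    have h : (antiparallelTwist (n + 1) (fun _ => true) d).writhe
        = (Tangle.sideCrossing false d).writhe
          + (antiparallelTwist n (fun _ => true) d.rev).writhe := rfl
    rw [h, writhe_antiparallelTwist n, writhe_sideCrossing_false]
    push_cast
    ring

theorem writhe_precursorOpen (n : ℕ) :
    Tangle.writhe (precursorOpen fun _ : Fin n => true) = -n := by
  have h : Tangle.writhe (precursorOpen fun _ : Fin n => true)
      = 0 + (antiparallelTwist n (fun _ => true) .dn).writhe := rfl
  rw [h, writhe_antiparallelTwist, zero_add]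

section TwistStateSum

variable {K : Type*} [Field K] {q : K}

theorem RT_antiparallelTwist_two (hq : q ≠ 0) (n : ℕ) (u : Lab 2 .nil) :
    (∀ i j : Fin 2, (antiparallelTwist n (fun _ => true) .dn).RT q 2 (i, j) u
        = ((q ^ 2)⁻¹) ^ n * if i = j then quantumWeight q i else 0)
      ∧ ∀ i j : Fin 2, (antiparallelTwist n (fun _ => true) .up).RT q 2 (i, j) u
        = ((q ^ 2)⁻¹) ^ n * if i = j then 1 else 0 := by
  induction n with
  | zero =>
    refine ⟨fun i j => (Tangle.RT_cup q .dn u i j).trans ?_,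
      fun i j => (Tangle.RT_cup q .up u i j).trans ?_⟩
    · rw [pow_zero, one_mul]
      rfl
    · rw [pow_zero, one_mul]
      rfl
  | succ n ih =>
    refine ⟨fun i j => (Tangle.RT_pair_comp_eq q (Tangle.RT_sideCrossing_dn q false i j)
      ih.2).trans ?_, fun i j => (Tangle.RT_pair_comp_eq q (Tangle.RT_sideCrossing_up q false i j)
      ih.1).trans ?_⟩
    · rw [pow_succ (q ^ 2)⁻¹ n]
      generalize ((q ^ 2)⁻¹) ^ n = c
      fin_cases i <;> fin_cases j <;>
        simp [Fin.sum_univ_two, rMatrix, quantumWeight]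
      all_goals field_simp
      all_goals ring
    · rw [pow_succ (q ^ 2)⁻¹ n]
      generalize ((q ^ 2)⁻¹) ^ n = c
      fin_cases i <;> fin_cases j <;>
        simp [Fin.sum_univ_two, rMatrix, quantumWeight]
      all_goals field_simp
      all_goals ring

theorem slN_two_precursorOpen (hq : q ≠ 0) (n : ℕ) :
    LinkDiagram.slN q 2 (precursorOpen fun _ : Fin n => true) = q + q⁻¹ := by
  have h : Tangle.RT q 2 (precursorOpen fun _ : Fin n => true) () ()
      = ∑ i : Fin 2, Tangle.capWeight q .dn i
        * (((q ^ 2)⁻¹) ^ n * if i = i then quantumWeight q i else 0) :=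
    Tangle.RT_cap_comp_eq q fun i => (RT_antiparallelTwist_two hq n ()).1 i i
  rw [LinkDiagram.slN, writhe_precursorOpen, h, neg_neg, zpow_natCast, inv_pow]
  have hn : (q ^ 2) ^ n ≠ 0 := pow_ne_zero _ (pow_ne_zero _ hq)
  simp only [Fin.sum_univ_two, Tangle.capWeight, if_true, one_mul, ← mul_add]
  rw [mul_inv_cancel_left₀ hn]
  simp [quantumWeight, add_comm]

theorem RT_parallelTwist_two (hq : q ≠ 0) (hs : q + q⁻¹ ≠ 0) (n : ℕ) :
    ((parallelTwist n fun _ => true).RT q 2 ((0 : Fin 2), (0 : Fin 2)) ((0 : Fin 2), (0 : Fin 2))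
        = q ^ n
      ∧ (parallelTwist n fun _ => true).RT q 2 ((1 : Fin 2), (1 : Fin 2)) ((1 : Fin 2), (1 : Fin 2))
        = q ^ n)
    ∧ ((parallelTwist n fun _ => true).RT q 2 ((0 : Fin 2), (1 : Fin 2)) ((0 : Fin 2), (1 : Fin 2))
        = (q * q ^ n + q⁻¹ * (-q⁻¹) ^ n) / (q + q⁻¹)
      ∧ (parallelTwist n fun _ => true).RT q 2 ((1 : Fin 2), (0 : Fin 2)) ((0 : Fin 2), (1 : Fin 2))
        = (q ^ n - (-q⁻¹) ^ n) / (q + q⁻¹))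
    ∧ ((parallelTwist n fun _ => true).RT q 2 ((0 : Fin 2), (1 : Fin 2)) ((1 : Fin 2), (0 : Fin 2))
        = (q ^ n - (-q⁻¹) ^ n) / (q + q⁻¹)
      ∧ (parallelTwist n fun _ => true).RT q 2 ((1 : Fin 2), (0 : Fin 2)) ((1 : Fin 2), (0 : Fin 2))
        = (q⁻¹ * q ^ n + q * (-q⁻¹) ^ n) / (q + q⁻¹)) := by
  induction n with
  | zero =>
    have h : ∀ i j k l : Fin 2, (parallelTwist 0 fun _ => true).RT q 2 (i, j) (k, l)
        = if i = k ∧ j = l then 1 else 0 := fun i j k l => Tangle.RT_strands_pair q _ i j k l rfl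
    refine ⟨⟨(h _ _ _ _).trans ?_, (h _ _ _ _).trans ?_⟩, ⟨(h _ _ _ _).trans ?_,
      (h _ _ _ _).trans ?_⟩, ⟨(h _ _ _ _).trans ?_, (h _ _ _ _).trans ?_⟩⟩ <;> simp
    · rw [div_self hs]
    · rw [add_comm, div_self hs]
  | succ n ih =>
    have h : ∀ i j k l : Fin 2, (parallelTwist (n + 1) fun _ => true).RT q 2 (i, j) (k, l)
        = ∑ x : Fin 2, ∑ y : Fin 2, rMatrix q true i j x y
          * (parallelTwist n fun _ => true).RT q 2 (x, y) (k, l) := fun i j k l =>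
      Tangle.RT_pair_comp_eq q (Tangle.RT_crossing_dn q true i j) fun _ _ => rfl
    obtain ⟨⟨h₁, h₂⟩, ⟨h₃, h₄⟩, ⟨h₅, h₆⟩⟩ := ih
    refine ⟨⟨(h _ _ _ _).trans ?_, (h _ _ _ _).trans ?_⟩, ⟨(h _ _ _ _).trans ?_,
      (h _ _ _ _).trans ?_⟩, ⟨(h _ _ _ _).trans ?_, (h _ _ _ _).trans ?_⟩⟩
    · simp [Fin.sum_univ_two, rMatrix, h₁, pow_succ']
    · simp [Fin.sum_univ_two, rMatrix, h₂, pow_succ']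
    · simp only [Fin.sum_univ_two, h₃, h₄, pow_succ']
      generalize (-q⁻¹) ^ n = c
      simp [rMatrix]
      field_simp
      ring
    · simp only [Fin.sum_univ_two, h₃, h₄, pow_succ']
      generalize (-q⁻¹) ^ n = c
      simp [rMatrix]
    · simp only [Fin.sum_univ_two, h₅, h₆, pow_succ']
      generalize (-q⁻¹) ^ n = c
      simp [rMatrix]
      field_simp
      ring
    · simp only [Fin.sum_univ_two, h₅, h₆, pow_succ']
      generalize (-q⁻¹) ^ n = c
      simp [rMatrix]
      field_simp
      ring

theorem slN_two_precursorClosed (hq : q ≠ 0) (hs : q + q⁻¹ ≠ 0) (n : ℕ) :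
    LinkDiagram.slN q 2 (precursorClosed fun _ : Fin n => true)
      = q ^ (-(n : ℤ)) * ((-q ^ 2) ^ (-(n : ℤ)) + q ^ 2 + q⁻¹ ^ 2 + 1) := by
  obtain ⟨⟨h₁, h₂⟩, ⟨h₃, _⟩, ⟨_, h₆⟩⟩ := RT_parallelTwist_two hq hs n
  rw [LinkDiagram.slN, writhe_precursorClosed, Tangle.RT_precursorClosed]
  simp only [Fin.sum_univ_two, h₁, h₂, h₃, h₆]
  have hw₀ : quantumWeight q (0 : Fin 2) = q⁻¹ := by simp [quantumWeight]
  have hw₁ : quantumWeight q (1 : Fin 2) = q := by simp [quantumWeight]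
  have hneg : (-q⁻¹) ^ n = (-q ^ 2)⁻¹ ^ n * q ^ n := by
    rw [← mul_pow]
    congr 1
    field_simp
  rw [hw₀, hw₁, zpow_neg, zpow_neg, zpow_neg, zpow_natCast, zpow_natCast, zpow_natCast, hneg,
    ← pow_mul, mul_comm 2 n, pow_mul, ← inv_pow (-q ^ 2)]
  have hn : q ^ n ≠ 0 := pow_ne_zero _ hq
  have hs' : q ^ 2 + 1 ≠ 0 := fun h => hs (by field_simp; linear_combination h)
  generalize (-q ^ 2)⁻¹ ^ n = c
  field_simp
  ring

end TwistStateSum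

theorem card_not_inverse {n : ℕ} (S : Finset (Fin n)) :
    (Finset.univ.filter fun i => (hypercubeVertex S i).inverse = false).card = S.card := by
  rw [Finset.card_filter,
    sum_hypercubeVertex S fun t => if t.inverse = false then 1 else 0]
  simp

theorem card_inverse {n : ℕ} (S : Finset (Fin n)) :
    (Finset.univ.filter fun i => (hypercubeVertex S i).inverse = true).card = n - S.card := by
  rw [Finset.card_filter,
    sum_hypercubeVertex S fun t => if t.inverse = true then 1 else 0]
  simp

theorem jonesOpen_hypercubeVertex {n : ℕ} (S : Finset (Fin n)) :
    jonesOpen (hypercubeVertex S) = qq + qq⁻¹ := by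
  have hS : S.card ≤ n := by simpa using S.card_le_univ
  rw [jonesOpen, precursor_hypercubeVertex, writhe_precursorOpen, card_not_inverse, card_inverse,
    planarOpen_hypercubeVertex]
  generalize S.card = k at *
  obtain ⟨d, rfl⟩ := Nat.exists_eq_add_of_le hS
  rw [Nat.add_sub_cancel_left, jonesFraming,
    show (-((k + d : ℕ) : ℤ) + k - d) / 2 = -(d : ℤ) by push_cast; omega,
    show -((3 * -((k + d : ℕ) : ℤ) + k - d) / 2) = ((k + 2 * d : ℕ) : ℤ) by push_cast; omega,
    zpow_neg, zpow_natCast, zpow_natCast]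
  have hq := qq_ne_zero
  have h₁ : qq + qq⁻¹ + -qq = qq⁻¹ := by ring
  have h₂ : 1 + -qq⁻¹ * (qq + qq⁻¹) = (-1) * (qq⁻¹) ^ 2 := by
    field_simp
    ring
  have h₃ : ((-1 : RatFunc ℚ) ^ d)⁻¹ * (-1) ^ d = 1 := inv_mul_cancel₀ (by simp)
  have h₄ : qq ^ (k + 2 * d) * (qq⁻¹) ^ (k + 2 * d) = 1 := by
    rw [← mul_pow, mul_inv_cancel₀ hq, one_pow]
  rw [h₁, h₂, mul_pow, ← pow_mul]
  calc _ = (qq + qq⁻¹) * (((-1 : RatFunc ℚ) ^ d)⁻¹ * (-1) ^ d)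
        * (qq ^ (k + 2 * d) * (qq⁻¹) ^ (k + 2 * d)) := by ring
    _ = _ := by rw [h₃, h₄, mul_one, mul_one]

theorem jonesClosed_hypercubeVertex {n : ℕ} (S : Finset (Fin n)) :
    jonesClosed (hypercubeVertex S)
      = qq ^ (-(n : ℤ)) * ((-qq ^ 2) ^ (-(n : ℤ)) + qq ^ 2 + qq⁻¹ ^ 2 + 1) := by
  have hS : S.card ≤ n := by simpa using S.card_le_univ
  rw [jonesClosed, precursor_hypercubeVertex, writhe_precursorClosed, card_not_inverse,
    card_inverse, planarClosed_hypercubeVertex]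
  generalize S.card = k at *
  obtain ⟨d, rfl⟩ := Nat.exists_eq_add_of_le hS
  rw [Nat.add_sub_cancel_left, jonesFraming,
    show (((k + d : ℕ) : ℤ) + k - d) / 2 = (k : ℤ) by push_cast; omega,
    show -((3 * ((k + d : ℕ) : ℤ) + k - d) / 2) = -((2 * k + d : ℕ) : ℤ) by push_cast; omega,
    zpow_neg, zpow_neg, zpow_neg, zpow_natCast, zpow_natCast, zpow_natCast, zpow_natCast,
    ← inv_pow, ← inv_pow, ← inv_pow]
  have hq := qq_ne_zero
  have h₁ : qq + qq⁻¹ + -qq = qq⁻¹ := by ring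
  have h₂ : 1 + -qq⁻¹ * (qq + qq⁻¹) = (-1) * (qq⁻¹) ^ 2 := by
    field_simp
    ring
  have h₃ : (-qq ^ 2)⁻¹ = (-1) * (qq⁻¹) ^ 2 := by
    rw [inv_neg, inv_pow, neg_one_mul]
  have h₄ : (-1 : RatFunc ℚ) ^ k * (-1) ^ k = 1 := by
    rw [← mul_pow, neg_one_mul, neg_neg, one_pow]
  have h₅ : qq⁻¹ ^ k * qq ^ k = 1 := by
    rw [← mul_pow, inv_mul_cancel₀ hq, one_pow]
  have h₆ : qq * qq⁻¹ = 1 := mul_inv_cancel₀ hq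
  rw [h₁, h₂, h₃, neg_pow qq k]
  have h₇ : (qq + qq⁻¹) ^ 2 - 1 = qq ^ 2 + qq⁻¹ ^ 2 + 1 := by
    linear_combination 2 * h₆
  rw [h₇]
  simp only [mul_pow]
  calc _ = qq⁻¹ ^ (k + d) * ((-1) ^ (k + d) * (qq⁻¹ ^ 2) ^ (k + d))
        + ((-1 : RatFunc ℚ) ^ k * (-1) ^ k) * (qq⁻¹ ^ k * qq ^ k) * qq⁻¹ ^ (k + d)
          * (qq ^ 2 + qq⁻¹ ^ 2 + 1) := by ring
    _ = _ := by
      rw [h₄, h₅]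
      ring

end Jones

theorem mainTheorem9 {n k : ℕ} (S : Finset (Fin n)) (hk : S.card = k)
    {𝕜 : Type*} [Field 𝕜] (φ φbar D : 𝕜) (hD : D ≠ 0) :
    -- The planar decomposition of a general vertex and of its closures, for generic `φ`, `φ̄`, `D`.
    (parCoeff φ φbar D (hypercubeVertex S) = φ ^ k
      ∧ cupcapCoeff φ φbar D (hypercubeVertex S) = Theta φ φbar D n k
      ∧ planarOpen φ φbar D (hypercubeVertex S) = φ ^ k * D + Theta φ φbar D n k * D ^ 2
      ∧ planarOpen φ φbar D (hypercubeVertex S) = D * (D + φ) ^ k * (1 + φbar * D) ^ (n - k)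
      ∧ planarClosed φ φbar D (hypercubeVertex S) = φ ^ k * D ^ 2 + Theta φ φbar D n k * D)
    -- The composition rule, and the rule with `φ` and `φ̄` exchanged.
    ∧ (∀ m l : ℕ, l ≤ m →
        Theta φ φbar D (n + m) (k + l)
            = φ ^ k * Theta φ φbar D m l + φ ^ l * Theta φ φbar D n k
              + D * Theta φ φbar D m l * Theta φ φbar D n k
        ∧ Theta φbar φ D (n + m) (k + l)
            = φbar ^ k * Theta φbar φ D m l + φbar ^ l * Theta φbar φ D n k
              + D * Theta φbar φ D m l * Theta φbar φ D n k)
    -- The decomposition of the actual tangle, for every `N`.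
    ∧ (∀ N : ℕ, 1 ≤ N →
        (chainTangle n (hypercubeVertex S)).RT qq N
          = specA N homPhi ^ k • Tangle.par.RT qq N
            + Theta (specA N homPhi) (specA N homPhiBar) (specA N homD) n k
              • Tangle.cupcap.RT qq N)
    -- The HOMFLY polynomial of the open closure.
    ∧ (∃ H : (RatFunc ℚ)[T;T⁻¹],
        IsHOMFLY (openClosure (chainTangle n (hypercubeVertex S))) H
        ∧ H = LaurentPolynomial.T (2 * (n : ℤ) - 4 * k)
            * (homD * (homD + homPhi) ^ k * (1 + homPhiBar * homD) ^ (n - k))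
        ∧ H = LaurentPolynomial.T (-2 * (k : ℤ)) * (homD * (homD + homPhi) ^ k)
        ∧ ∃ F : ℤ[T;T⁻¹][T;T⁻¹],
            braceA ^ k * H = homD ^ (k + 1) * (braceA ^ k + braceAqAq * fromInt F))
    -- The HOMFLY polynomial of the closed closure.
    ∧ (∃ H : (RatFunc ℚ)[T;T⁻¹],
        IsHOMFLY (closedClosure (chainTangle n (hypercubeVertex S))) H
        ∧ H = LaurentPolynomial.T (2 * (n : ℤ) - 4 * k)
            * ((homD + homPhi) ^ k * (1 + homPhiBar * homD) ^ (n - k)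
              + homPhi ^ k * (homD ^ 2 - 1))
        ∧ (1 ≤ k → ∃ F : ℤ[T;T⁻¹][T;T⁻¹],
            braceA ^ (k - 1) * H = homD ^ k * (braceA ^ (k - 1) + braceAqAq * fromInt F)))
    -- All vertices have the same precursor, hence the same precursor Jones polynomials, which are
    -- the `sl_2` invariants of the precursor links.
    ∧ (∀ S' : Finset (Fin n), precursor (hypercubeVertex S') = precursor (hypercubeVertex S))
    ∧ (jonesOpen (hypercubeVertex S) = qq + qq⁻¹
        ∧ LinkDiagram.slN qq 2 (precursorOpen (precursor (hypercubeVertex S))) = qq + qq⁻¹)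
    ∧ (jonesClosed (hypercubeVertex S)
          = qq ^ (-(n : ℤ)) * ((-qq ^ 2) ^ (-(n : ℤ)) + qq ^ 2 + qq⁻¹ ^ 2 + 1)
        ∧ LinkDiagram.slN qq 2 (precursorClosed (precursor (hypercubeVertex S)))
          = qq ^ (-(n : ℤ)) * ((-qq ^ 2) ^ (-(n : ℤ)) + qq ^ 2 + qq⁻¹ ^ 2 + 1)) := by
  subst hk
  have hS : S.card ≤ n := by simpa using S.card_le_univ
  have hΘ := Theta_mul_self (φ := φ) (φbar := φbar) hD n S.card
  refine ⟨⟨parCoeff_hypercubeVertex φ φbar D S, cupcapCoeff_hypercubeVertex φ φbar hD S, ?_,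
      planarOpen_hypercubeVertex φ φbar D S, ?_⟩,
    fun m l hl => ⟨Theta_add hD hS hl, Theta_add hD hS hl⟩,
    fun N hN => RT_chainTangle_qq hN S,
    ⟨_, isHOMFLY_openClosure S, rfl, HOMFLY_openClosure_eq hS, ?_⟩,
    ⟨_, isHOMFLY_closedClosure S, rfl, exists_integral_closedClosure hS⟩,
    fun S' => by rw [precursor_hypercubeVertex, precursor_hypercubeVertex],
    ⟨jonesOpen_hypercubeVertex S, ?_⟩, jonesClosed_hypercubeVertex S, ?_⟩
  · rw [planarOpen_hypercubeVertex]
    linear_combination -D * hΘ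
  · rw [planarClosed_hypercubeVertex]
    linear_combination -hΘ
  · rw [HOMFLY_openClosure_eq hS]
    exact exists_integral_openClosure S.card
  · rw [precursor_hypercubeVertex]
    exact slN_two_precursorOpen qq_ne_zero n
  · rw [precursor_hypercubeVertex]
    exact slN_two_precursorClosed qq_ne_zero qq_add_inv_ne_zero n
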